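/- Let $n\ge 1$ and consider a network of $n$ qubits labelled by $\mathsf V=\{1,\dots,n\}$, with state space $\mathcal H^{\otimes n}$, $\mathcal H=\mathbb C^2$, so that operators on it are elements of $\mathbb C^{2^n\times 2^n}$. For a permutation $\pi$ of $\mathsf V$ let $U_\pi$ be the operator with $U_\pi|q_1\dots q_n\rangle=|q_{\pi(1)}\dots q_{\pi(n)}\rangle$ for $q_i\in\{0,1\}$, and for $j\ne k$ let $U_{jk}$ be the swapping operator that exchanges qubits $j$ and $k$. Let $\mathscr P_*(\rho)=\frac1{n!}\sum_\pi U_\pi\rho U_\pi^\dagger$. Let $\alpha_{jk}=\alpha_{kj}>0$ ($j\neq k$) be constants. Let $\sigma$ assign to each time $t\in[0,\infty)$ a simple undirected graph $\mathsf G_{\sigma(t)}=(\mathsf V,\mathsf E_{\sigma(t)})$; assume that $\sigma$ is piecewise constant and right-continuous and that there is a constant $\tau_D>0$ which is a lower bound for the time between any two consecutive switching instants of $\sigma$. Consider the quantum consensus master equation $$\frac{d\rho}{dt}=\sum_{\{j,k\}\in\mathsf E_{\sigma(t)}}\alpha_{jk}\big(U_{jk}\rho U_{jk}^\dagger-\rho\big),\qquad(\ast)$$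 whose solutions on $[t_0,\infty)$ are the continuous functions that satisfy $(\ast)$ at all $t>t_0$ other than the switching instants. The system achieves *global asymptotic quantum consensus* if for every initial time $t_0\ge0$ and every initial state $\rho(t_0)$ the solution satisfies $\lim_{t\to\infty}\rho(t)=\mathscr P_*(\rho(t_0))$. It achieves *global exponential quantum consensus* if there are a constant $\gamma>0$, and for each initial state $\rho_0$ a constant $C(\rho_0)>0$ (depending on $\rho_0$ only), such that for all initial times $t_0\ge 0$ and all initial states $\rho(t_0)$ $$\|\rho(t)-\mathscr P_*(\rho(t_0))\|\le C(\rho(t_0))\,e^{-\gamma(t-t_0)},\qquad t\ge t_0,$$ where $\|\cdot\|$ is the Frobenius norm (any other norm gives the same notion). For $I\subseteq[0,\infty)$ let $\mathsf G(I)=(\mathsf V,\bigcup_{s\in I}\mathsf E_{\sigma(s)})$. Then the following hold, both when the initial states range over all density operators (positive semidefinite matrices of trace one) and when they range over all of $\mathbb C^{2^n\times2^n}$: (i) The system $(\ast)$ achieves global exponential quantum consensus if and only if there exists a constant $T>0$ such that $\mathsf G([t,t+T))$ is connected for all $t\ge0$. (ii) The system $(\ast)$ achieves global asymptotic quantum consensus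 if and only if $\mathsf G([t,\infty))$ is connected for all $t\ge0$. -/

import Mathlib

open Filter Topology Set
open scoped ComplexOrder

attribute [local instance] Matrix.frobeniusNormedAddCommGroup Matrix.frobeniusNormedSpace

namespace QuantumConsensus

/-- Labels `q = (q₁, …, qₙ) ∈ {0,1}ⁿ` of the computational basis `|q₁⟩ ⊗ ⋯ ⊗ |qₙ⟩` of the
state space of `n` qubits. -/
abbrev Label (n : ℕ) : Type := Fin n → Fin 2

/-- Operators on the `2ⁿ`-dimensional state space, as matrices in the computational basis.
The norm used on them is the Frobenius norm. -/
abbrev Op (n : ℕ) : Type := Matrix (Label n) (Label n) ℂ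

/-- The operator `U_π`, `U_π |q₁ … qₙ⟩ = |q_{π(1)} … q_{π(n)}⟩`. -/
def permOp {n : ℕ} (π : Equiv.Perm (Fin n)) : Op n :=
  Matrix.of fun p q => if p = fun i => q (π i) then 1 else 0

/-- The swapping operator `U_{jk}`, exchanging the contents of qubits `j` and `k`. -/
def swapOp {n : ℕ} (j k : Fin n) : Op n := permOp (Equiv.swap j k)

/-- The quantum average `(1 / n!) ∑_π U_π ρ U_π†`. -/
noncomputable def quantumAverage {n : ℕ} (ρ : Op n) : Op n :=
  ((n.factorial : ℂ))⁻¹ • ∑ π : Equiv.Perm (Fin n), permOp π * ρ * (permOp π).conjTranspose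

/-- Density operators: positive semidefinite Hermitian matrices of trace one. -/
def densityOperators (n : ℕ) : Set (Op n) := {ρ | ρ.PosSemidef ∧ ρ.trace = 1}

open Classical in
/-- Right-hand side of the quantum consensus master equation for the interaction graph `G`:
the sum over the edges `{j, k}` (each taken once, with `j < k`) of `α_{jk} (U_{jk} ρ U_{jk}† - ρ)`. -/
noncomputable def consensusField {n : ℕ} (α : Fin n → Fin n → ℝ) (G : SimpleGraph (Fin n))
    (ρ : Op n) : Op n :=
  ∑ j : Fin n, ∑ k : Fin n,
    if j < k ∧ G.Adj j k then
      (α j k : ℂ) • (swapOp j k * ρ * (swapOp j k).conjTranspose - ρ)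
    else 0

/-- `t > 0` is a switching instant of `σ` if `σ` is not constant near `t`. -/
def IsSwitchingInstant {n : ℕ} (σ : ℝ → SimpleGraph (Fin n)) (t : ℝ) : Prop :=
  0 < t ∧ ¬ ∀ᶠ s in 𝓝 t, σ s = σ t

/-- `σ`, restricted to `[0, ∞)`, is a piecewise constant switching signal with a positive dwell
time: it is right-continuous (at a switching instant it takes the value of the interval that
starts there), and distinct switching instants are at least some `τ > 0` apart.
Values of `σ` at negative times play no role. -/
def IsSwitchingSignal {n : ℕ} (σ : ℝ → SimpleGraph (Fin n)) : Prop :=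
  (∀ t : ℝ, 0 ≤ t → ∀ᶠ s in 𝓝[≥] t, σ s = σ t) ∧
  ∃ τ : ℝ, 0 < τ ∧ ∀ s t : ℝ, IsSwitchingInstant σ s → IsSwitchingInstant σ t → s < t → τ ≤ t - s

/-- `ρ` solves the quantum consensus master equation on `[t₀, ∞)`: it is continuous there and
satisfies the differential equation at all `t > t₀` that are not switching instants. -/
def IsSolution {n : ℕ} (α : Fin n → Fin n → ℝ) (σ : ℝ → SimpleGraph (Fin n)) (t₀ : ℝ)
    (ρ : ℝ → Op n) : Prop :=
  ContinuousOn ρ (Ici t₀) ∧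
  ∀ t : ℝ, t₀ < t → ¬ IsSwitchingInstant σ t → HasDerivAt ρ (consensusField α (σ t) (ρ t)) t

/-- Global asymptotic quantum consensus, for initial states in `S`. -/
def GlobalAsymptoticConsensus {n : ℕ} (α : Fin n → Fin n → ℝ) (σ : ℝ → SimpleGraph (Fin n))
    (S : Set (Op n)) : Prop :=
  ∀ t₀ : ℝ, 0 ≤ t₀ → ∀ ρ : ℝ → Op n, IsSolution α σ t₀ ρ → ρ t₀ ∈ S →
    Tendsto ρ atTop (𝓝 (quantumAverage (ρ t₀)))

/-- Global exponential quantum consensus, for initial states in `S`: the rate `γ` is uniform, and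
the constant `C` depends on the initial state only (not on the initial time). -/
def GlobalExponentialConsensus {n : ℕ} (α : Fin n → Fin n → ℝ) (σ : ℝ → SimpleGraph (Fin n))
    (S : Set (Op n)) : Prop :=
  ∃ C : Op n → ℝ, (∀ ρ₀, 0 < C ρ₀) ∧ ∃ γ : ℝ, 0 < γ ∧
    ∀ t₀ : ℝ, 0 ≤ t₀ → ∀ ρ : ℝ → Op n, IsSolution α σ t₀ ρ → ρ t₀ ∈ S →
      ∀ t : ℝ, t₀ ≤ t →
        ‖ρ t - quantumAverage (ρ t₀)‖ ≤ C (ρ t₀) * Real.exp (-γ * (t - t₀))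

/-- The union graph of `σ` over the time set `I`: its edges are those of all `σ s`, `s ∈ I`. -/
def unionGraph {n : ℕ} (σ : ℝ → SimpleGraph (Fin n)) (I : Set ℝ) : SimpleGraph (Fin n) :=
  ⨆ s ∈ I, σ s

end QuantumConsensus

/-!
The average `ρ̄` of a solution `ρ` over all permutations is conserved, and the deviation `x = ρ - ρ̄`
solves the same equation. The swaps `ρ ↦ U_{jk} ρ U_{jk}†` are isometric involutions for the
Frobenius norm, so `‖x‖²` is dissipated at the rate `∑ α_{jk} ‖S_{jk} x - x‖²`, the sum running over
the active edges.

**Connectivity implies consensus.** On an interval of constant graph whose length is the dwell time,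
the dissipation at the start is at most a constant times the energy lost on the interval
(`IsTrajectory.dissipation_le`). Follow a window `[t, b)` whose union graph is connected. Whenever
edges appear that are not among the earlier ones, they remain active for a dwell time; hence
`x` is then almost fixed by the new swaps, up to the energy lost, while its distance to the
operators fixed by the earlier swaps has not increased in the meantime. After finitely many such
stages `x` is close to the permutation invariant operators (`exists_near_fixedVectors_top`). As `x`
has zero average, this bounds `‖x‖²` at the end of the window by a constant times the energy lost,
so `‖x‖²` contracts by a factor `θ < 1` that does not depend on the length of the window
(`exists_contraction`). Windows of bounded length give exponential decay, and arbitrary windows give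
convergence.

**Consensus implies connectivity.** If the union graph over some time set is disconnected, let `q`
be the indicator of a component. The state `|q⟩⟨q|` is fixed by all swaps that are active, but not by
all permutations. A solution that starts there stays there, without reaching its average: forever,
if the graphs are disconnected on `[t, ∞)`, and for a time `T`, if they are on `[t, t + T)`, which
contradicts an exponential bound when `T` is large, because there are only finitely many such
states. The second case needs the existence of solutions on `[t, ∞)` (`exists_solution`).
-/

namespace QuantumConsensus

/-! ### Switching signals -/

section Signals

variable {Γ : Type*} {σ : ℝ → Γ}

/-- A right-continuous signal that leaves the set `Q` has a first time at which it is outside. -/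
lemma exists_first_exit (hr : ∀ t : ℝ, 0 ≤ t → ∀ᶠ s in 𝓝[≥] t, σ s = σ t) (Q : Γ → Prop)
    {a s : ℝ} (ha : 0 ≤ a) (has : a ≤ s) (hs : ¬ Q (σ s)) :
    ∃ r ∈ Icc a s, ¬ Q (σ r) ∧ ∀ u ∈ Ico a r, Q (σ u) := by
  set B : Set ℝ := {u | a ≤ u ∧ ¬ Q (σ u)} with hB
  have hne : B.Nonempty := ⟨s, has, hs⟩
  have hbd : BddBelow B := ⟨a, fun u hu => hu.1⟩
  have har : a ≤ sInf B := le_csInf hne fun u hu => hu.1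
  refine ⟨sInf B, ⟨har, csInf_le hbd ⟨has, hs⟩⟩, ?_, ?_⟩
  · obtain ⟨e, he, hconst⟩ :=
      mem_nhdsGE_iff_exists_Ico_subset.1 (hr _ (ha.trans har))
    obtain ⟨u, hu, hue⟩ := exists_lt_of_csInf_lt hne he
    have : σ u = σ (sInf B) := hconst ⟨csInf_le hbd hu, hue⟩
    rw [← this]
    exact hu.2
  · intro u hu
    by_contra hQ
    exact absurd (csInf_le hbd ⟨hu.1, hQ⟩) (not_le.2 hu.2)

lemma eq_of_forall_not_isSwitchingInstant {n : ℕ} {σ : ℝ → SimpleGraph (Fin n)}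
    (hr : ∀ t : ℝ, 0 ≤ t → ∀ᶠ s in 𝓝[≥] t, σ s = σ t) {a b : ℝ} (ha : 0 ≤ a)
    (h : ∀ u ∈ Ioo a b, ¬ IsSwitchingInstant σ u) : ∀ s ∈ Ico a b, σ s = σ a := by
  intro s hs
  by_contra hne
  obtain ⟨r, hr1, hr2, hr3⟩ := exists_first_exit hr (fun g => g = σ a) ha hs.1 hne
  have har : a < r := lt_of_le_of_ne hr1.1 fun h => hr2 (by rw [h])
  refine h r ⟨har, hr1.2.trans_lt hs.2⟩ ⟨ha.trans_lt har, fun hev => hr2 ?_⟩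
  have h1 : ∀ᶠ u in 𝓝[<] r, σ u = σ r := hev.filter_mono nhdsWithin_le_nhds
  obtain ⟨u, hu1, hu2⟩ := (h1.and (Ioo_mem_nhdsLT har)).exists
  rw [← hu1]
  exact hr3 u ⟨hu2.1.le, hu2.2⟩

/-- Dwell time: at a time `t > 0` a switching signal is constant to the left of `t`, or keeps its
value during a time `τ` from `t` on. -/
lemma IsSwitchingSignal.exists_dwell {n : ℕ} {σ : ℝ → SimpleGraph (Fin n)}
    (hσ : IsSwitchingSignal σ) :
    ∃ τ : ℝ, 0 < τ ∧ ∀ t : ℝ, 0 < t →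
      (∀ᶠ s in 𝓝[<] t, σ s = σ t) ∨ ∀ s ∈ Ico t (t + τ), σ s = σ t := by
  obtain ⟨hr, τ, hτ, hd⟩ := hσ
  refine ⟨τ, hτ, fun t ht => ?_⟩
  by_cases hsw : IsSwitchingInstant σ t
  · right
    refine eq_of_forall_not_isSwitchingInstant hr ht.le fun u hu hu' => ?_
    have := hd t u hsw hu' hu.1
    linarith [hu.2]
  · left
    have : ∀ᶠ s in 𝓝 t, σ s = σ t := by
      by_contra h
      exact hsw ⟨ht, h⟩
    exact this.filter_mono nhdsWithin_le_nhds

/-- From time `t` on, the signal keeps its value up to some time `a < t + τ`, and then has a constant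
value during a full dwell time `τ`; here `a = t` is allowed. -/
lemma exists_constant_interval (hr : ∀ t : ℝ, 0 ≤ t → ∀ᶠ s in 𝓝[≥] t, σ s = σ t) {τ : ℝ}
    (hτ : 0 < τ) (hd : ∀ t : ℝ, 0 < t →
      (∀ᶠ s in 𝓝[<] t, σ s = σ t) ∨ ∀ s ∈ Ico t (t + τ), σ s = σ t) {t : ℝ} (ht : 0 ≤ t) :
    ∃ a ∈ Ico t (t + τ), (∀ s ∈ Ico t a, σ s = σ t) ∧ ∀ s ∈ Ico a (a + τ), σ s = σ a := by
  by_cases h : ∀ s ∈ Ico t (t + τ), σ s = σ t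
  · exact ⟨t, ⟨le_rfl, by linarith⟩, by simp, h⟩
  push Not at h
  obtain ⟨s, hs, hne⟩ := h
  obtain ⟨r, hr1, hr2, hr3⟩ := exists_first_exit hr (fun g => g = σ t) ht hs.1 hne
  have htr : t < r := lt_of_le_of_ne hr1.1 fun h => hr2 (by rw [h])
  refine ⟨r, ⟨hr1.1, hr1.2.trans_lt hs.2⟩, hr3, ?_⟩
  refine (hd r (ht.trans_lt htr)).resolve_left fun hl => hr2 ?_
  obtain ⟨u, hu1, hu2⟩ := (hl.and (Ioo_mem_nhdsLT htr)).exists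
  rw [← hu1]
  exact hr3 u ⟨hu2.1.le, hu2.2⟩

end Signals

/-! ### Switched linear systems -/

section Switched

variable {Γ E : Type*} [NormedAddCommGroup E] [NormedSpace ℝ E]

/-- `x` is a trajectory on `[t₀, ∞)` of the switched linear system `x' = L (σ t) x`, in the sense of
right derivatives, which exist at the switching instants too. -/
def IsTrajectory (L : Γ → E →ₗ[ℝ] E) (σ : ℝ → Γ) (t₀ : ℝ) (x : ℝ → E) : Prop :=
  ContinuousOn x (Ici t₀) ∧ ∀ t, t₀ ≤ t → HasDerivWithinAt x (L (σ t) (x t)) (Ici t) t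

lemma IsTrajectory.continuousOn_Icc {L : Γ → E →ₗ[ℝ] E} {σ : ℝ → Γ} {t₀ : ℝ} {x : ℝ → E}
    (hx : IsTrajectory L σ t₀ x) {a b : ℝ} (ha : t₀ ≤ a) : ContinuousOn x (Icc a b) :=
  hx.1.mono fun _ h => ha.trans h.1

lemma IsTrajectory.sub_const {L : Γ → E →ₗ[ℝ] E} {σ : ℝ → Γ} {t₀ : ℝ} {x : ℝ → E}
    (hx : IsTrajectory L σ t₀ x) {v : E} (hv : ∀ g, L g v = 0) :
    IsTrajectory L σ t₀ (fun t => x t - v) := by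
  refine ⟨hx.1.sub continuousOn_const, fun t ht => ?_⟩
  have := (hx.2 t ht).sub_const v
  simpa [hv] using this

/-- A function that is continuous on `[a, b]` with nonpositive right derivative on `[a, b)` does not
increase from `a` to `b`. -/
lemma le_of_hasDerivWithinAt_Ici_nonpos {f f' : ℝ → ℝ} {a b : ℝ} (hab : a ≤ b)
    (hf : ContinuousOn f (Icc a b)) (hf' : ∀ t ∈ Ico a b, HasDerivWithinAt f (f' t) (Ici t) t)
    (h : ∀ t ∈ Ico a b, f' t ≤ 0) : f b ≤ f a :=
  image_le_of_deriv_right_le_deriv_boundary (B := fun _ => f a) (B' := fun _ => 0) hf hf' le_rfl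
    continuousOn_const (fun _ _ => hasDerivWithinAt_const ..) h ⟨hab, le_rfl⟩

/-- A continuous function that satisfies `x' = L (σ t) x` at the times `t > t₀` at which `σ` is
locally constant also satisfies it, as a right derivative, at the remaining times. -/
lemma isTrajectory_of_hasDerivAt {L : Γ → E →ₗ[ℝ] E} [FiniteDimensional ℝ E] {σ : ℝ → Γ}
    (hr : ∀ t : ℝ, 0 ≤ t → ∀ᶠ s in 𝓝[≥] t, σ s = σ t) {t₀ : ℝ} (ht₀ : 0 ≤ t₀) {x : ℝ → E}
    (hc : ContinuousOn x (Ici t₀))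
    (hd : ∀ t, t₀ < t → (∀ᶠ s in 𝓝 t, σ s = σ t) → HasDerivAt x (L (σ t) (x t)) t) :
    IsTrajectory L σ t₀ x := by
  refine ⟨hc, fun t ht => ?_⟩
  obtain ⟨e, he, hconst⟩ := mem_nhdsGE_iff_exists_Ico_subset.1 (hr t (ht₀.trans ht))
  have key : ∀ s ∈ Ioo t e, HasDerivAt x (L (σ t) (x s)) s := by
    intro s hs
    have hst : σ s = σ t := hconst ⟨hs.1.le, hs.2⟩
    rw [← hst]
    refine hd s (ht.trans_lt hs.1) ?_
    filter_upwards [Ioo_mem_nhds hs.1 hs.2] with u hu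
    rw [hst]
    exact hconst ⟨hu.1.le, hu.2⟩
  refine hasDerivWithinAt_Ici_of_tendsto_deriv (s := Ioo t e)
    (fun s hs => (key s hs).differentiableAt.differentiableWithinAt)
    ((hc t ht).mono fun s hs => ht.trans hs.1.le) (Ioo_mem_nhdsGT he) ?_
  have h1 : Tendsto (fun s => L (σ t) (x s)) (𝓝[>] t) (𝓝 (L (σ t) (x t))) :=
    ((L (σ t)).continuous_of_finiteDimensional.tendsto _).comp
      (((hc t ht).mono fun s (hs : t < s) => ht.trans hs.le).tendsto)
  refine h1.congr' ?_
  filter_upwards [Ioo_mem_nhdsGT he] with s hs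
  exact (key s hs).deriv.symm

end Switched

/-! ### Energy and dissipation of swap dynamics -/

section Energy

variable {n : ℕ} {E : Type*} [NormedAddCommGroup E] [InnerProductSpace ℝ E]

open Classical in
/-- The edges `{j, k}` of `G`, each taken once, as pairs with `j < k`. -/
noncomputable def edgePairs (G : SimpleGraph (Fin n)) : Finset (Fin n × Fin n) :=
  Finset.univ.filter fun p => p.1 < p.2 ∧ G.Adj p.1 p.2

lemma mem_edgePairs {G : SimpleGraph (Fin n)} {p : Fin n × Fin n} :
    p ∈ edgePairs G ↔ p.1 < p.2 ∧ G.Adj p.1 p.2 := by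
  classical
  simp [edgePairs]

/-- The generator `x ↦ ∑ α_{jk} (S_{jk} x - x)` of the swap dynamics on the graph `G`, where `S_{jk}`
are arbitrary linear maps standing for the action of the swaps. -/
noncomputable def swapField (S : Fin n → Fin n → E →ₗ[ℝ] E) (α : Fin n → Fin n → ℝ)
    (G : SimpleGraph (Fin n)) : E →ₗ[ℝ] E :=
  ∑ p ∈ edgePairs G, α p.1 p.2 • (S p.1 p.2 - LinearMap.id)

/-- The rate `∑ α_{jk} ‖S_{jk} x - x‖²` at which the swap dynamics on `G` dissipates `‖x‖²`. -/
noncomputable def dissipation (S : Fin n → Fin n → E →ₗ[ℝ] E) (α : Fin n → Fin n → ℝ)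
    (G : SimpleGraph (Fin n)) (x : E) : ℝ :=
  ∑ p ∈ edgePairs G, α p.1 p.2 * ‖S p.1 p.2 x - x‖ ^ 2

/-- The vectors fixed by all swaps along edges of `G`, that is, the equilibria of its dynamics. -/
def fixedVectors (S : Fin n → Fin n → E →ₗ[ℝ] E) (G : SimpleGraph (Fin n)) : Set E :=
  {v | ∀ p ∈ edgePairs G, S p.1 p.2 v = v}

variable {S : Fin n → Fin n → E →ₗ[ℝ] E} {α : Fin n → Fin n → ℝ}

lemma swapField_apply (G : SimpleGraph (Fin n)) (x : E) :
    swapField S α G x = ∑ p ∈ edgePairs G, α p.1 p.2 • (S p.1 p.2 x - x) := by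
  simp [swapField]

lemma edgePairs_mono {F G : SimpleGraph (Fin n)} (h : F ≤ G) : edgePairs F ⊆ edgePairs G :=
  fun _ hp => mem_edgePairs.2 ⟨(mem_edgePairs.1 hp).1, h (mem_edgePairs.1 hp).2⟩

lemma fixedVectors_anti {F G : SimpleGraph (Fin n)} (h : F ≤ G) :
    fixedVectors S G ⊆ fixedVectors S F := fun _ hv p hp => hv p (edgePairs_mono h hp)

lemma swapField_of_mem_fixedVectors {G : SimpleGraph (Fin n)} {v : E} (hv : v ∈ fixedVectors S G) :
    swapField S α G v = 0 := by
  rw [swapField_apply]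
  exact Finset.sum_eq_zero fun p hp => by rw [hv p hp, sub_self, smul_zero]

lemma dissipation_sub {G : SimpleGraph (Fin n)} {v : E} (hv : v ∈ fixedVectors S G) (x : E) :
    dissipation S α G (x - v) = dissipation S α G x := by
  refine Finset.sum_congr rfl fun p hp => ?_
  rw [map_sub, hv p hp, sub_sub_sub_cancel_right]

section Weights

variable (hα : ∀ j k, j ≠ k → 0 < α j k)
include hα

lemma weight_pos {G : SimpleGraph (Fin n)} {p : Fin n × Fin n} (hp : p ∈ edgePairs G) :
    0 < α p.1 p.2 := hα _ _ (mem_edgePairs.1 hp).1.ne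

lemma dissipation_nonneg (G : SimpleGraph (Fin n)) (x : E) : 0 ≤ dissipation S α G x :=
  Finset.sum_nonneg fun _ hp => mul_nonneg (weight_pos hα hp).le (sq_nonneg _)

lemma dissipation_sup_le (F G : SimpleGraph (Fin n)) (x : E) :
    dissipation S α (F ⊔ G) x ≤ dissipation S α F x + dissipation S α G x := by
  classical
  have hsub : edgePairs (F ⊔ G) ⊆ edgePairs F ∪ edgePairs G := fun p hp => by
    rw [Finset.mem_union, mem_edgePairs, mem_edgePairs]
    rw [mem_edgePairs, SimpleGraph.sup_adj] at hp
    tauto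
  have hnn : ∀ p ∈ edgePairs F ∪ edgePairs G, 0 ≤ α p.1 p.2 * ‖S p.1 p.2 x - x‖ ^ 2 := by
    intro p hp
    rcases Finset.mem_union.1 hp with hp | hp
    all_goals exact mul_nonneg (weight_pos hα hp).le (sq_nonneg _)
  calc dissipation S α (F ⊔ G) x
      ≤ ∑ p ∈ edgePairs F ∪ edgePairs G, α p.1 p.2 * ‖S p.1 p.2 x - x‖ ^ 2 :=
        Finset.sum_le_sum_of_subset_of_nonneg hsub fun p hp _ => hnn p hp
    _ ≤ _ := by
        rw [dissipation, dissipation, ← Finset.sum_union_inter]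
        refine le_add_of_nonneg_right (Finset.sum_nonneg fun p hp => hnn p ?_)
        exact Finset.mem_union_left _ (Finset.mem_inter.1 hp).1

lemma sum_weight_le (G : SimpleGraph (Fin n)) :
    ∑ p ∈ edgePairs G, α p.1 p.2 ≤ ∑ p ∈ edgePairs (⊤ : SimpleGraph (Fin n)), α p.1 p.2 :=
  Finset.sum_le_sum_of_subset_of_nonneg (edgePairs_mono le_top) fun _ hp _ => (weight_pos hα hp).le

lemma norm_swapField_sq_le (G : SimpleGraph (Fin n)) (x : E) :
    ‖swapField S α G x‖ ^ 2 ≤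
      (∑ p ∈ edgePairs (⊤ : SimpleGraph (Fin n)), α p.1 p.2) * dissipation S α G x := by
  have h1 : ‖swapField S α G x‖ ≤ ∑ p ∈ edgePairs G, α p.1 p.2 * ‖S p.1 p.2 x - x‖ := by
    rw [swapField_apply]
    refine (norm_sum_le _ _).trans (Finset.sum_le_sum fun p hp => ?_)
    rw [norm_smul, Real.norm_of_nonneg (weight_pos hα hp).le]
  calc ‖swapField S α G x‖ ^ 2
      ≤ (∑ p ∈ edgePairs G, α p.1 p.2 * ‖S p.1 p.2 x - x‖) ^ 2 := by gcongr
    _ ≤ (∑ p ∈ edgePairs G, α p.1 p.2) * dissipation S α G x := by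
        refine Finset.sum_sq_le_sum_mul_sum_of_sq_le_mul _ (fun p hp => (weight_pos hα hp).le)
          (fun p hp => mul_nonneg (weight_pos hα hp).le (sq_nonneg _)) fun p _ => le_of_eq (by ring)
    _ ≤ _ := mul_le_mul_of_nonneg_right (sum_weight_le hα G) (dissipation_nonneg hα G x)

lemma dissipation_le (hiso : ∀ j k x, ‖S j k x‖ = ‖x‖) (G : SimpleGraph (Fin n)) (x : E) :
    dissipation S α G x ≤
      4 * (∑ p ∈ edgePairs (⊤ : SimpleGraph (Fin n)), α p.1 p.2) * ‖x‖ ^ 2 := by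
  have h : ∀ p : Fin n × Fin n, ‖S p.1 p.2 x - x‖ ^ 2 ≤ 4 * ‖x‖ ^ 2 := fun p => by
    have h1 : ‖S p.1 p.2 x - x‖ ≤ 2 * ‖x‖ := by
      have := norm_sub_le (S p.1 p.2 x) x
      rw [hiso] at this
      linarith
    calc ‖S p.1 p.2 x - x‖ ^ 2 ≤ (2 * ‖x‖) ^ 2 := by gcongr
      _ = _ := by ring
  calc dissipation S α G x ≤ ∑ p ∈ edgePairs G, α p.1 p.2 * (4 * ‖x‖ ^ 2) :=
        Finset.sum_le_sum fun p hp => mul_le_mul_of_nonneg_left (h p) (weight_pos hα hp).le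
    _ = 4 * (∑ p ∈ edgePairs G, α p.1 p.2) * ‖x‖ ^ 2 := by rw [← Finset.sum_mul]; ring
    _ ≤ _ := mul_le_mul_of_nonneg_right
        (mul_le_mul_of_nonneg_left (sum_weight_le hα G) (by norm_num)) (sq_nonneg _)

/-- In finite dimension, the distance to the vectors fixed by the swaps of `G` is controlled by the
dissipation. -/
lemma exists_mem_fixedVectors_norm_sub_sq_le [FiniteDimensional ℝ E] :
    ∃ C : ℝ, 0 ≤ C ∧ ∀ (G : SimpleGraph (Fin n)) (x : E), ∃ v ∈ fixedVectors S G,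
      ‖x - v‖ ^ 2 ≤ C * dissipation S α G x := by
  classical
  have key : ∀ G : SimpleGraph (Fin n), ∃ C : ℝ, 0 ≤ C ∧ ∀ x : E, ∃ v ∈ fixedVectors S G,
      ‖x - v‖ ^ 2 ≤ C * dissipation S α G x := by
    intro G
    -- The fixed vectors are the kernel of `f`; a generalized inverse of `f` provides a projection.
    let f : E →ₗ[ℝ] (edgePairs G → E) := LinearMap.pi fun p => S p.1.1 p.1.2 - LinearMap.id
    obtain ⟨g, hg⟩ : ∃ g : (edgePairs G → E) →ₗ[ℝ] E, ∀ x, f (g (f x)) = f x := by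
      obtain ⟨g₀, hg₀⟩ := f.rangeRestrict.exists_rightInverse_of_surjective f.range_rangeRestrict
      obtain ⟨g, hg⟩ := LinearMap.exists_extend g₀
      refine ⟨g, fun x => ?_⟩
      have h1 : g (f x) = g₀ (f.rangeRestrict x) := LinearMap.congr_fun hg (f.rangeRestrict x)
      have h2 := LinearMap.congr_fun hg₀ (f.rangeRestrict x)
      rw [h1]
      exact congrArg Subtype.val h2
    have hpos : ∀ p ∈ edgePairs G, 0 < α p.1 p.2 := fun p hp => weight_pos hα hp
    let gc : (edgePairs G → E) →L[ℝ] E := LinearMap.toContinuousLinearMap g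
    refine ⟨‖gc‖ ^ 2 * ∑ p ∈ edgePairs G, (α p.1 p.2)⁻¹, ?_, fun x => ⟨x - g (f x), ?_, ?_⟩⟩
    · exact mul_nonneg (sq_nonneg _) (Finset.sum_nonneg fun p hp => (inv_pos.2 (hpos p hp)).le)
    · intro p hp
      have h1 : f (x - g (f x)) ⟨p, hp⟩ = 0 := by rw [map_sub, hg, sub_self]; rfl
      exact sub_eq_zero.1 h1
    · have h1 : ‖f x‖ ^ 2 ≤ (∑ p ∈ edgePairs G, (α p.1 p.2)⁻¹) * dissipation S α G x := by
        have hC : 0 ≤ (∑ p ∈ edgePairs G, (α p.1 p.2)⁻¹) * dissipation S α G x :=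
          mul_nonneg (Finset.sum_nonneg fun p hp => (inv_pos.2 (hpos p hp)).le)
            (dissipation_nonneg hα G x)
        have h2 : ‖f x‖ ≤ √((∑ p ∈ edgePairs G, (α p.1 p.2)⁻¹) * dissipation S α G x) := by
          refine (pi_norm_le_iff_of_nonneg (Real.sqrt_nonneg _)).2 fun p => ?_
          refine Real.le_sqrt_of_sq_le ?_
          have h3 : (α p.1.1 p.1.2)⁻¹ ≤ ∑ p ∈ edgePairs G, (α p.1 p.2)⁻¹ :=
            Finset.single_le_sum (f := fun p : Fin n × Fin n => (α p.1 p.2)⁻¹)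
              (fun p hp => (inv_pos.2 (hpos p hp)).le) p.2
          have h4 : α p.1.1 p.1.2 * ‖S p.1.1 p.1.2 x - x‖ ^ 2 ≤ dissipation S α G x :=
            Finset.single_le_sum (f := fun p : Fin n × Fin n => α p.1 p.2 * ‖S p.1 p.2 x - x‖ ^ 2)
              (fun p hp => mul_nonneg (hpos p hp).le (sq_nonneg _)) p.2
          have h5 := hpos p.1 p.2
          calc ‖f x p‖ ^ 2
              = (α p.1.1 p.1.2)⁻¹ * (α p.1.1 p.1.2 * ‖S p.1.1 p.1.2 x - x‖ ^ 2) := by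
                rw [← mul_assoc, inv_mul_cancel₀ h5.ne', one_mul]; rfl
            _ ≤ _ := mul_le_mul h3 h4 (by positivity) ((inv_pos.2 h5).le.trans h3)
        calc ‖f x‖ ^ 2 ≤ _ := pow_le_pow_left₀ (norm_nonneg _) h2 2
          _ = _ := Real.sq_sqrt hC
      calc ‖x - (x - g (f x))‖ ^ 2 = ‖gc (f x)‖ ^ 2 := by rw [sub_sub_cancel]; rfl
        _ ≤ (‖gc‖ * ‖f x‖) ^ 2 := by gcongr; exact gc.le_opNorm _
        _ = ‖gc‖ ^ 2 * ‖f x‖ ^ 2 := by ring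
        _ ≤ ‖gc‖ ^ 2 * ((∑ p ∈ edgePairs G, (α p.1 p.2)⁻¹) * dissipation S α G x) := by gcongr
        _ = _ := by ring
  choose C hC0 hC using key
  refine ⟨∑ G, C G, Finset.sum_nonneg fun G _ => hC0 G, fun G x => ?_⟩
  obtain ⟨v, hv, h⟩ := hC G x
  refine ⟨v, hv, h.trans (mul_le_mul_of_nonneg_right ?_ (dissipation_nonneg hα G x))⟩
  exact Finset.single_le_sum (fun G _ => hC0 G) (Finset.mem_univ G)

end Weights

section Isometric

variable (hiso : ∀ j k x, ‖S j k x‖ = ‖x‖)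
include hiso

lemma two_mul_inner_swapField (G : SimpleGraph (Fin n)) (x : E) :
    2 * inner ℝ x (swapField S α G x) = -dissipation S α G x := by
  rw [swapField_apply, inner_sum, dissipation, Finset.mul_sum, ← Finset.sum_neg_distrib]
  refine Finset.sum_congr rfl fun p _ => ?_
  rw [inner_smul_right, inner_sub_right, norm_sub_sq_real, hiso, real_inner_self_eq_norm_sq,
    real_inner_comm]
  ring

/-- Polarization: for isometric involutions `S_{jk}` the generator is the symmetric operator
associated with the dissipation. -/
lemma sum_inner_swap_sub (hinv : ∀ j k x, S j k (S j k x) = x) (G : SimpleGraph (Fin n)) (x y : E) :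
    ∑ p ∈ edgePairs G, α p.1 p.2 * inner ℝ (S p.1 p.2 x - x) (S p.1 p.2 y - y) =
      -2 * inner ℝ (swapField S α G x) y := by
  have hpol : ∀ j k x y, inner ℝ (S j k x) (S j k y) = inner ℝ x y := by
    intro j k x y
    rw [real_inner_eq_norm_add_mul_self_sub_norm_mul_self_sub_norm_mul_self_div_two,
      real_inner_eq_norm_add_mul_self_sub_norm_mul_self_sub_norm_mul_self_div_two, ← map_add,
      hiso, hiso, hiso]
  have hsym : ∀ j k x y, inner ℝ x (S j k y) = inner ℝ (S j k x) y := by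
    intro j k x y
    rw [← hpol j k x, hinv]
  rw [swapField_apply, sum_inner, Finset.mul_sum]
  refine Finset.sum_congr rfl fun p _ => ?_
  rw [inner_smul_left, inner_sub_left, inner_sub_left, inner_sub_right, inner_sub_right, hpol, hsym]
  simp only [conj_trivial]
  ring

variable {σ : ℝ → SimpleGraph (Fin n)} {t₀ : ℝ} {x : ℝ → E}

lemma IsTrajectory.hasDerivWithinAt_norm_sq (hx : IsTrajectory (swapField S α) σ t₀ x) {t : ℝ}
    (ht : t₀ ≤ t) :
    HasDerivWithinAt (fun s => ‖x s‖ ^ 2) (-dissipation S α (σ t) (x t)) (Ici t) t := by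
  have := (hx.2 t ht).norm_sq
  rwa [two_mul_inner_swapField hiso] at this

/-- While only swaps fixing `v` are active, the distance to `v` does not increase. -/
lemma IsTrajectory.norm_sub_le (hα : ∀ j k, j ≠ k → 0 < α j k)
    (hx : IsTrajectory (swapField S α) σ t₀ x) {F : SimpleGraph (Fin n)} {v : E}
    (hv : v ∈ fixedVectors S F) {a b : ℝ} (ha : t₀ ≤ a) (hab : a ≤ b)
    (hF : ∀ s ∈ Ico a b, σ s ≤ F) : ‖x b - v‖ ^ 2 ≤ ‖x a - v‖ ^ 2 := by
  refine le_of_hasDerivWithinAt_Ici_nonpos (f := fun t => ‖x t - v‖ ^ 2)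
    (f' := fun t => -dissipation S α (σ t) (x t - v)) hab
    (((hx.continuousOn_Icc ha).sub continuousOn_const).norm.pow 2) (fun t ht => ?_) fun t _ =>
      neg_nonpos.2 (dissipation_nonneg hα _ _)
  have h1 := ((hx.2 t (ha.trans ht.1)).sub_const v).norm_sq
  have h2 : swapField S α (σ t) (x t - v) = swapField S α (σ t) (x t) := by
    rw [map_sub, swapField_of_mem_fixedVectors (fixedVectors_anti (hF t ht) hv), sub_zero]
  rwa [← h2, two_mul_inner_swapField hiso] at h1

lemma IsTrajectory.norm_sq_le (hα : ∀ j k, j ≠ k → 0 < α j k)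
    (hx : IsTrajectory (swapField S α) σ t₀ x) {a b : ℝ} (ha : t₀ ≤ a) (hab : a ≤ b) :
    ‖x b‖ ^ 2 ≤ ‖x a‖ ^ 2 := by
  have h0 : (0 : E) ∈ fixedVectors S (⊤ : SimpleGraph (Fin n)) := fun p _ => map_zero _
  simpa using hx.norm_sub_le hiso hα h0 ha hab fun s _ => le_top

/-- On an interval of length `h` with constant graph, the dissipation at the start is controlled by
the energy lost. The dissipation may decay along the interval, but no faster than a multiple of the
energy does. -/
lemma IsTrajectory.dissipation_le (hα : ∀ j k, j ≠ k → 0 < α j k)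
    (hinv : ∀ j k x, S j k (S j k x) = x)
    (hx : IsTrajectory (swapField S α) σ t₀ x) {a h : ℝ} (ha : t₀ ≤ a) (hh : 0 < h)
    (hconst : ∀ s ∈ Ico a (a + h), σ s = σ a) :
    dissipation S α (σ a) (x a) ≤
      (1 / h + 4 * ∑ p ∈ edgePairs (⊤ : SimpleGraph (Fin n)), α p.1 p.2) *
        (‖x a‖ ^ 2 - ‖x (a + h)‖ ^ 2) := by
  set Λ := ∑ p ∈ edgePairs (⊤ : SimpleGraph (Fin n)), α p.1 p.2 with hΛ
  have hΛ0 : 0 ≤ Λ := Finset.sum_nonneg fun p hp => (weight_pos hα hp).le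
  set G := σ a with hG
  set q : ℝ → ℝ := fun t => dissipation S α G (x t) with hq
  set D := ‖x a‖ ^ 2 - ‖x (a + h)‖ ^ 2 with hD
  have hVd : ∀ t ∈ Ico a (a + h), HasDerivWithinAt (fun s => ‖x s‖ ^ 2) (-q t) (Ici t) t := by
    intro t ht
    have := hx.hasDerivWithinAt_norm_sq hiso (ha.trans ht.1)
    rwa [hconst t ht] at this
  have hqd : ∀ t ∈ Ico a (a + h), HasDerivWithinAt q
      (-4 * ‖swapField S α G (x t)‖ ^ 2) (Ici t) t := by
    intro t ht
    have hxt := hx.2 t (ha.trans ht.1)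
    rw [hconst t ht] at hxt
    have hS : ∀ p : Fin n × Fin n, HasDerivWithinAt (fun s => S p.1 p.2 (x s))
        (S p.1 p.2 (swapField S α G (x t))) (Ici t) t := by
      intro p
      have : Continuous (S p.1 p.2) :=
        AddMonoidHomClass.continuous_of_bound (S p.1 p.2) 1 fun y => by rw [hiso, one_mul]
      exact (ContinuousLinearMap.hasFDerivAt ⟨S p.1 p.2, this⟩).comp_hasDerivWithinAt t hxt
    have h1 := HasDerivWithinAt.fun_sum (u := edgePairs G) fun p _ =>
      (((hS p).sub hxt).norm_sq).const_mul (α p.1 p.2)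
    refine (h1.congr_deriv ?_)
    have h2 := sum_inner_swap_sub (α := α) hiso hinv G (x t) (swapField S α G (x t))
    rw [real_inner_self_eq_norm_sq] at h2
    have h3 : -4 * ‖swapField S α G (x t)‖ ^ 2 = 2 * (-2 * ‖swapField S α G (x t)‖ ^ 2) := by ring
    rw [h3, ← h2, Finset.mul_sum]
    refine Finset.sum_congr rfl fun p _ => ?_
    simp only [Pi.sub_apply]
    ring
  have hcx : ContinuousOn x (Icc a (a + h)) := hx.continuousOn_Icc ha
  have hcV : ContinuousOn (fun s => ‖x s‖ ^ 2) (Icc a (a + h)) := hcx.norm.pow 2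
  have hcq : ContinuousOn q (Icc a (a + h)) := by
    refine continuousOn_finsetSum _ fun p _ => continuousOn_const.mul (ContinuousOn.pow ?_ 2)
    have : Continuous (S p.1 p.2) :=
      AddMonoidHomClass.continuous_of_bound (S p.1 p.2) 1 fun y => by rw [hiso, one_mul]
    exact ((this.comp_continuousOn hcx).sub hcx).norm
  -- `4 Λ ‖x‖² - q` does not increase, as `q' = -4 ‖field‖² ≥ -4 Λ q`
  have hlow : ∀ t ∈ Ico a (a + h), q a - 4 * Λ * D ≤ q t := by
    intro t ht
    have hsub : Icc a t ⊆ Icc a (a + h) := Icc_subset_Icc_right ht.2.le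
    have h1 := le_of_hasDerivWithinAt_Ici_nonpos (f := fun s => 4 * Λ * ‖x s‖ ^ 2 - q s)
      (f' := fun s => 4 * Λ * -q s - -4 * ‖swapField S α G (x s)‖ ^ 2) ht.1
      ((continuousOn_const.mul (hcV.mono hsub)).sub (hcq.mono hsub))
      (fun s hs => ((hVd s ⟨hs.1, hs.2.trans ht.2⟩).const_mul (4 * Λ)).sub
        (hqd s ⟨hs.1, hs.2.trans ht.2⟩))
      (fun s hs => by
        have := norm_swapField_sq_le (S := S) hα G (x s)
        simp only [hq]
        linarith)
    have h2 : ‖x (a + h)‖ ^ 2 ≤ ‖x t‖ ^ 2 := hx.norm_sq_le hiso hα (ha.trans ht.1) ht.2.le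
    have h3 : 4 * Λ * (‖x a‖ ^ 2 - ‖x t‖ ^ 2) ≤ 4 * Λ * D := by
      rw [hD]
      gcongr
    linarith
  have h4 := le_of_hasDerivWithinAt_Ici_nonpos (f := fun s => ‖x s‖ ^ 2 + (q a - 4 * Λ * D) * (s - a))
    (f' := fun s => -q s + (q a - 4 * Λ * D) * 1) (by linarith : a ≤ a + h)
    (hcV.add (by fun_prop))
    (fun s hs => (hVd s hs).add (((hasDerivWithinAt_id s _).sub_const a).const_mul _))
    (fun s hs => by have := hlow s hs; linarith)
  simp only [add_sub_cancel_left, sub_self, mul_zero, add_zero] at h4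
  have h5 : (q a - 4 * Λ * D) * h ≤ D := by rw [hD]; linarith
  have h6 : q a - 4 * Λ * D ≤ D / h := (le_div_iff₀ hh).2 h5
  have h7 : q a ≤ (1 / h + 4 * Λ) * D := by
    have : (1 / h + 4 * Λ) * D = D / h + 4 * Λ * D := by ring
    linarith
  exact h7

end Isometric

end Energy

/-! ### Uniform contraction over a jointly connected window -/

section Contraction

variable {n : ℕ} {E : Type*} [NormedAddCommGroup E] [InnerProductSpace ℝ E]
  [FiniteDimensional ℝ E] {S : Fin n → Fin n → E →ₗ[ℝ] E} {α : Fin n → Fin n → ℝ}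
  {σ : ℝ → SimpleGraph (Fin n)} {τ : ℝ}

lemma le_unionGraph {I : Set ℝ} {s : ℝ} (hs : s ∈ I) : σ s ≤ unionGraph σ I :=
  le_iSup₂_of_le s hs le_rfl

lemma unionGraph_le {I : Set ℝ} {F : SimpleGraph (Fin n)} (h : ∀ s ∈ I, σ s ≤ F) :
    unionGraph σ I ≤ F := iSup₂_le h

/-- Suppose that at time `a` the state is close, relative to a bound `D` for the energy lost during
time intervals of length `τ`, to the vectors fixed by the swaps of `F`, and that `F` and the graphs
active during `[a, b)` are jointly connected. Then at some time of `[a, b]` the state is close to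
the vectors fixed by all swaps. The constant depends neither on the trajectory nor on the time
interval.

By induction on the number `m` of graphs above `F`: at the first time `r` at which edges outside
`F` are active, the distance to the fixed vectors of `F` has not increased since `a`, and the new
edges stay active for a time `τ`, so the bound on the energy lost gives closeness to the fixed
vectors of `F ⊔ σ r`. -/
lemma exists_near_fixedVectors_top (hα : ∀ j k, j ≠ k → 0 < α j k)
    (hiso : ∀ j k x, ‖S j k x‖ = ‖x‖) (hinv : ∀ j k x, S j k (S j k x) = x)
    (hconn : ∀ F : SimpleGraph (Fin n), F.Connected → fixedVectors S F ⊆ fixedVectors S ⊤)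
    (hr : ∀ t : ℝ, 0 ≤ t → ∀ᶠ s in 𝓝[≥] t, σ s = σ t) (hτ : 0 < τ)
    (hd : ∀ t : ℝ, 0 < t → (∀ᶠ s in 𝓝[<] t, σ s = σ t) ∨ ∀ s ∈ Ico t (t + τ), σ s = σ t)
    (m : ℕ) : ∀ c : ℝ, 0 ≤ c → ∃ K : ℝ, 0 ≤ K ∧ ∀ F : SimpleGraph (Fin n), (Ioi F).ncard ≤ m →
      ∀ (x : ℝ → E) (t₀ a b D : ℝ), 0 ≤ t₀ → IsTrajectory (swapField S α) σ t₀ x →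
        t₀ ≤ a → 0 ≤ D →
        (∀ s ∈ Icc a b, ‖x s‖ ^ 2 - ‖x (s + τ)‖ ^ 2 ≤ D) →
        ((∀ s ∈ Ico a (a + τ), σ s = σ a) ∨ σ a ≤ F) →
        (F ⊔ unionGraph σ (Ico a b)).Connected → a ≤ b →
        (∃ v ∈ fixedVectors S F, ‖x a - v‖ ^ 2 ≤ c * D) →
        ∃ r ∈ Icc a b, ∃ v ∈ fixedVectors S ⊤, ‖x r - v‖ ^ 2 ≤ K * D := by
  obtain ⟨C, hC0, hC⟩ := exists_mem_fixedVectors_norm_sub_sq_le (S := S) hα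
  set Λ := ∑ p ∈ edgePairs (⊤ : SimpleGraph (Fin n)), α p.1 p.2 with hΛ
  have hΛ0 : 0 ≤ Λ := Finset.sum_nonneg fun p hp => (weight_pos hα hp).le
  induction m with
  | zero =>
    intro c hc
    refine ⟨c, hc, fun F hF x t₀ a b D ht₀ hx ha hD hloss hstart hcon hab ⟨v, hv, hvD⟩ => ?_⟩
    refine ⟨a, ⟨le_rfl, hab⟩, v, ?_, hvD⟩
    have hFtop : ⊤ ≤ F := by
      by_contra hne
      have : (⊤ : SimpleGraph (Fin n)) ∈ Ioi F := lt_of_le_not_ge le_top hne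
      rw [(Set.ncard_eq_zero (toFinite _)).1 (Nat.le_zero.1 hF)] at this
      exact this
    exact fixedVectors_anti hFtop hv
  | succ m ih =>
    intro c hc
    obtain ⟨K, hK0, hK⟩ := ih (C * (4 * Λ * c + (1 / τ + 4 * Λ))) (by positivity)
    refine ⟨max c K, le_max_of_le_left hc,
      fun F hF x t₀ a b D ht₀ hx ha hD hloss hstart hcon hab ⟨v, hv, hvD⟩ => ?_⟩
    by_cases hall : ∀ s ∈ Ico a b, σ s ≤ F
    · refine ⟨a, ⟨le_rfl, hab⟩, v, hconn F ?_ hv, hvD.trans ?_⟩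
      · rwa [sup_eq_left.2 (unionGraph_le hall)] at hcon
      · exact mul_le_mul_of_nonneg_right (le_max_left _ _) hD
    push Not at hall
    obtain ⟨s, hs, hsF⟩ := hall
    obtain ⟨r, hr1, hrF, hrle⟩ :=
      exists_first_exit hr (fun g => g ≤ F) (ht₀.trans ha) hs.1 hsF
    have hrb : r < b := hr1.2.trans_lt hs.2
    have hdw : ∀ s ∈ Ico r (r + τ), σ s = σ r := by
      rcases eq_or_lt_of_le hr1.1 with h | h
      · subst h
        exact hstart.resolve_right hrF
      · refine (hd r ((ht₀.trans ha).trans_lt h)).resolve_left fun hl => hrF ?_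
        obtain ⟨u, hu1, hu2⟩ := (hl.and (Ioo_mem_nhdsLT h)).exists
        rw [← hu1]
        exact hrle u ⟨hu2.1.le, hu2.2⟩
    have htr : t₀ ≤ r := ha.trans hr1.1
    have h1 : ‖x r - v‖ ^ 2 ≤ c * D := (hx.norm_sub_le hiso hα hv ha hr1.1 hrle).trans hvD
    have h2 : dissipation S α F (x r) ≤ 4 * Λ * c * D := by
      rw [← dissipation_sub hv]
      calc _ ≤ 4 * Λ * ‖x r - v‖ ^ 2 := dissipation_le hα hiso F _
        _ ≤ 4 * Λ * (c * D) := by gcongr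
        _ = _ := by ring
    have h3 : dissipation S α (σ r) (x r) ≤ (1 / τ + 4 * Λ) * D :=
      (hx.dissipation_le hiso hα hinv htr hτ hdw).trans
        (mul_le_mul_of_nonneg_left (hloss r ⟨hr1.1, hrb.le⟩) (by positivity))
    obtain ⟨w, hw, hwD⟩ := hC (F ⊔ σ r) (x r)
    have hlt : F < F ⊔ σ r := left_lt_sup.2 hrF
    have h4 : (Ioi (F ⊔ σ r)).ncard ≤ m :=
      Nat.le_of_lt_succ ((Set.ncard_lt_ncard (Ioi_ssubset_Ioi hlt) (toFinite _)).trans_le hF)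
    have h5 : F ⊔ unionGraph σ (Ico a b) ≤ F ⊔ σ r ⊔ unionGraph σ (Ico r b) := by
      refine sup_le (le_sup_of_le_left le_sup_left) (unionGraph_le fun s hs => ?_)
      rcases lt_or_ge s r with h | h
      · exact (hrle s ⟨hs.1, h⟩).trans (le_sup_of_le_left le_sup_left)
      · exact le_sup_of_le_right (le_unionGraph ⟨h, hs.2⟩)
    have h6 : ‖x r - w‖ ^ 2 ≤ C * (4 * Λ * c + (1 / τ + 4 * Λ)) * D :=
      calc _ ≤ C * dissipation S α (F ⊔ σ r) (x r) := hwD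
        _ ≤ C * (4 * Λ * c * D + (1 / τ + 4 * Λ) * D) := by
          gcongr
          exact (dissipation_sup_le hα F (σ r) (x r)).trans (add_le_add h2 h3)
        _ = _ := by ring
    obtain ⟨q, hq, u, hu, huD⟩ := hK (F ⊔ σ r) h4 x t₀ r b D ht₀ hx htr hD
      (fun s hs => hloss s ⟨hr1.1.trans hs.1, hs.2⟩) (Or.inr le_sup_right)
      (hcon.mono h5) hrb.le ⟨w, hw, h6⟩
    exact ⟨q, ⟨hr1.1.trans hq.1, hq.2⟩, u, hu,
      huD.trans (mul_le_mul_of_nonneg_right (le_max_right _ _) hD)⟩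

/-- The energy of a trajectory without component along the vectors fixed by all swaps contracts by
a uniform factor over each jointly connected window, however long. -/
lemma exists_contraction (hα : ∀ j k, j ≠ k → 0 < α j k)
    (hiso : ∀ j k x, ‖S j k x‖ = ‖x‖) (hinv : ∀ j k x, S j k (S j k x) = x)
    (hconn : ∀ F : SimpleGraph (Fin n), F.Connected → fixedVectors S F ⊆ fixedVectors S ⊤)
    (hr : ∀ t : ℝ, 0 ≤ t → ∀ᶠ s in 𝓝[≥] t, σ s = σ t) (hτ : 0 < τ)
    (hd : ∀ t : ℝ, 0 < t → (∀ᶠ s in 𝓝[<] t, σ s = σ t) ∨ ∀ s ∈ Ico t (t + τ), σ s = σ t) :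
    ∃ θ : ℝ, 0 < θ ∧ θ < 1 ∧ ∀ (x : ℝ → E) (t₀ t b : ℝ), 0 ≤ t₀ →
      IsTrajectory (swapField S α) σ t₀ x →
      (∀ s, t₀ ≤ s → ∀ v ∈ fixedVectors S ⊤, ‖x s‖ ≤ 2 * ‖x s - v‖) →
      t₀ ≤ t → t + τ ≤ b → (unionGraph σ (Ico (t + τ) b)).Connected →
      ‖x (b + τ)‖ ^ 2 ≤ θ * ‖x t‖ ^ 2 := by
  obtain ⟨K, hK0, hK⟩ := exists_near_fixedVectors_top (S := S) hα hiso hinv hconn hr hτ hd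
    (Ioi (⊥ : SimpleGraph (Fin n))).ncard 0 le_rfl
  refine ⟨(4 * K + 1) / (4 * K + 2), by positivity, (div_lt_one (by positivity)).2 (by linarith),
    fun x t₀ t b ht₀ hx hfix ht htb hcon => ?_⟩
  obtain ⟨a, ha, -, hac⟩ := exists_constant_interval hr hτ hd (ht₀.trans ht)
  have hta : t₀ ≤ a := ht.trans ha.1
  have hab : a ≤ b := ha.2.le.trans htb
  have hmono : ∀ {u w : ℝ}, t₀ ≤ u → u ≤ w → ‖x w‖ ^ 2 ≤ ‖x u‖ ^ 2 :=
    fun hu huw => hx.norm_sq_le hiso hα hu huw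
  set D := ‖x t‖ ^ 2 - ‖x (b + τ)‖ ^ 2 with hD
  have hD0 : 0 ≤ D := sub_nonneg.2 (hmono ht (by linarith))
  obtain ⟨r, hr1, v, hv, hvD⟩ := hK ⊥ le_rfl x t₀ a b D ht₀ hx hta hD0
    (fun s hs => sub_le_sub (hmono ht (ha.1.trans hs.1))
      (hmono (by linarith [hs.1]) (by linarith [hs.2])))
    (Or.inl hac)
    (hcon.mono (le_sup_of_le_right (unionGraph_le fun s hs =>
      le_unionGraph ⟨ha.2.le.trans hs.1, hs.2⟩))) hab
    ⟨x a, fun p hp => absurd (mem_edgePairs.1 hp).2 (by simp), by simp⟩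
  have h1 : ‖x (b + τ)‖ ^ 2 ≤ 4 * K * D :=
    calc ‖x (b + τ)‖ ^ 2 ≤ ‖x r‖ ^ 2 := hmono (hta.trans hr1.1) (by linarith [hr1.2])
      _ ≤ (2 * ‖x r - v‖) ^ 2 := by gcongr; exact hfix r (hta.trans hr1.1) v hv
      _ = 4 * ‖x r - v‖ ^ 2 := by ring
      _ ≤ 4 * K * D := by linarith
  have h2 : 0 ≤ ‖x t‖ ^ 2 := sq_nonneg _
  have h3 : ‖x (b + τ)‖ ^ 2 ≤ ‖x t‖ ^ 2 := sub_nonneg.1 hD0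
  rw [div_mul_eq_mul_div, le_div_iff₀ (by positivity)]
  rw [hD] at h1
  linarith

/-- If every window of length `T` is jointly connected, such trajectories decay exponentially, at a
uniform rate. -/
lemma exists_exponential_decay (hα : ∀ j k, j ≠ k → 0 < α j k)
    (hiso : ∀ j k x, ‖S j k x‖ = ‖x‖) (hinv : ∀ j k x, S j k (S j k x) = x)
    (hconn : ∀ F : SimpleGraph (Fin n), F.Connected → fixedVectors S F ⊆ fixedVectors S ⊤)
    (hr : ∀ t : ℝ, 0 ≤ t → ∀ᶠ s in 𝓝[≥] t, σ s = σ t) (hτ : 0 < τ)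
    (hd : ∀ t : ℝ, 0 < t → (∀ᶠ s in 𝓝[<] t, σ s = σ t) ∨ ∀ s ∈ Ico t (t + τ), σ s = σ t)
    {T : ℝ} (hT : 0 < T) (hG : ∀ t : ℝ, 0 ≤ t → (unionGraph σ (Ico t (t + T))).Connected) :
    ∃ M γ : ℝ, 0 < M ∧ 0 < γ ∧ ∀ (x : ℝ → E) (t₀ : ℝ), 0 ≤ t₀ →
      IsTrajectory (swapField S α) σ t₀ x →
      (∀ s, t₀ ≤ s → ∀ v ∈ fixedVectors S ⊤, ‖x s‖ ≤ 2 * ‖x s - v‖) →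
      ∀ t, t₀ ≤ t → ‖x t‖ ≤ M * ‖x t₀‖ * Real.exp (-γ * (t - t₀)) := by
  obtain ⟨θ, hθ0, hθ1, hθ⟩ := exists_contraction (S := S) hα hiso hinv hconn hr hτ hd
  set W := τ + T + τ with hW
  have hW0 : 0 < W := by positivity
  have hlog : Real.log θ < 0 := Real.log_neg hθ0 hθ1
  refine ⟨√(θ⁻¹), -Real.log θ / (2 * W), by positivity, by
    apply div_pos <;> linarith, fun x t₀ ht₀ hx hfix t ht => ?_⟩
  have hstep : ∀ k : ℕ, ‖x (t₀ + k * W)‖ ^ 2 ≤ θ ^ k * ‖x t₀‖ ^ 2 := by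
    intro k
    induction k with
    | zero => simp
    | succ k ih =>
      have hk : 0 ≤ (k : ℝ) * W := by positivity
      have h1 := hθ x t₀ (t₀ + k * W) (t₀ + k * W + τ + T) ht₀ hx hfix (by linarith) (by linarith)
        (hG _ (by linarith))
      have h2 : t₀ + ((k + 1 : ℕ) : ℝ) * W = t₀ + k * W + τ + T + τ := by
        push_cast
        rw [hW]
        ring
      rw [h2, pow_succ' θ k]
      calc _ ≤ _ := h1
        _ ≤ θ * (θ ^ k * ‖x t₀‖ ^ 2) := by gcongr
        _ = _ := by ring
  set k := ⌊(t - t₀) / W⌋₊ with hk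
  have hq : 0 ≤ (t - t₀) / W := div_nonneg (by linarith) hW0.le
  have hk1 : (k : ℝ) * W ≤ t - t₀ := (le_div_iff₀ hW0).1 (Nat.floor_le hq)
  have hk2 : (t - t₀) / W - 1 ≤ k := by linarith [Nat.lt_floor_add_one ((t - t₀) / W)]
  have hpow : θ ^ k ≤ θ⁻¹ * Real.exp (Real.log θ * ((t - t₀) / W)) := by
    have h1 : θ ^ k = Real.exp (Real.log θ * k) := by
      rw [← Real.rpow_natCast, Real.rpow_def_of_pos hθ0]
    have h2 : θ⁻¹ = Real.exp (-Real.log θ) := by rw [Real.exp_neg, Real.exp_log hθ0]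
    rw [h1, h2, ← Real.exp_add]
    refine Real.exp_le_exp.2 ?_
    have := mul_le_mul_of_nonpos_left hk2 hlog.le
    linarith
  have h1 : ‖x t‖ ^ 2 ≤ (√(θ⁻¹) * ‖x t₀‖ * Real.exp (-(-Real.log θ / (2 * W)) * (t - t₀))) ^ 2 := by
    calc ‖x t‖ ^ 2 ≤ ‖x (t₀ + k * W)‖ ^ 2 :=
          hx.norm_sq_le hiso hα (by linarith [mul_nonneg (Nat.cast_nonneg k) hW0.le]) (by linarith)
      _ ≤ θ ^ k * ‖x t₀‖ ^ 2 := hstep k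
      _ ≤ θ⁻¹ * Real.exp (Real.log θ * ((t - t₀) / W)) * ‖x t₀‖ ^ 2 := by gcongr
      _ = _ := by
        rw [mul_pow, mul_pow, Real.sq_sqrt (by positivity), ← Real.exp_nat_mul]
        have : ((2 : ℕ) : ℝ) * (-(-Real.log θ / (2 * W)) * (t - t₀)) =
            Real.log θ * ((t - t₀) / W) := by
          push_cast
          field_simp
        rw [this]
        ring
  exact (sq_le_sq₀ (norm_nonneg _) (by positivity)).1 h1

/-- The graphs active after time `t` are all active already before some finite time. -/
lemma exists_unionGraph_Ici_le (t : ℝ) :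
    ∃ b, t ≤ b ∧ unionGraph σ (Ici t) ≤ unionGraph σ (Ico t b) := by
  classical
  have h : ∀ p : Fin n × Fin n, ∃ b : ℝ, t ≤ b ∧
      ((unionGraph σ (Ici t)).Adj p.1 p.2 → ∃ s ∈ Ico t b, (σ s).Adj p.1 p.2) := by
    intro p
    by_cases hp : (unionGraph σ (Ici t)).Adj p.1 p.2
    · obtain ⟨s, hs⟩ : ∃ s, ∃ _ : s ∈ Ici t, (σ s).Adj p.1 p.2 := by
        simpa [unionGraph, SimpleGraph.iSup_adj] using hp
      exact ⟨s + 1, by linarith [mem_Ici.1 hs.1], fun _ => ⟨s, ⟨hs.1, by linarith⟩, hs.2⟩⟩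
    · exact ⟨t, le_rfl, fun h => absurd h hp⟩
  choose f hf1 hf2 using h
  obtain ⟨b, hb⟩ := (Set.finite_range f).bddAbove
  refine ⟨max t b, le_max_left _ _, fun j k hjk => ?_⟩
  obtain ⟨s, hs, hadj⟩ := hf2 (j, k) hjk
  have h1 : s ∈ Ico t (max t b) :=
    ⟨hs.1, hs.2.trans_le ((hb (mem_range_self (j, k))).trans (le_max_right _ _))⟩
  exact le_unionGraph h1 hadj

/-- If the graphs active after any given time are jointly connected, such trajectories tend to
zero. -/
lemma tendsto_zero_of_connected (hα : ∀ j k, j ≠ k → 0 < α j k)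
    (hiso : ∀ j k x, ‖S j k x‖ = ‖x‖) (hinv : ∀ j k x, S j k (S j k x) = x)
    (hconn : ∀ F : SimpleGraph (Fin n), F.Connected → fixedVectors S F ⊆ fixedVectors S ⊤)
    (hr : ∀ t : ℝ, 0 ≤ t → ∀ᶠ s in 𝓝[≥] t, σ s = σ t) (hτ : 0 < τ)
    (hd : ∀ t : ℝ, 0 < t → (∀ᶠ s in 𝓝[<] t, σ s = σ t) ∨ ∀ s ∈ Ico t (t + τ), σ s = σ t)
    (hG : ∀ t : ℝ, 0 ≤ t → (unionGraph σ (Ici t)).Connected) {x : ℝ → E} {t₀ : ℝ} (ht₀ : 0 ≤ t₀)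
    (hx : IsTrajectory (swapField S α) σ t₀ x)
    (hfix : ∀ s, t₀ ≤ s → ∀ v ∈ fixedVectors S ⊤, ‖x s‖ ≤ 2 * ‖x s - v‖) :
    Tendsto (fun t => ‖x t‖) atTop (𝓝 0) := by
  obtain ⟨θ, hθ0, hθ1, hθ⟩ := exists_contraction (S := S) hα hiso hinv hconn hr hτ hd
  have hstep : ∀ k : ℕ, ∃ t, t₀ ≤ t ∧ ‖x t‖ ^ 2 ≤ θ ^ k * ‖x t₀‖ ^ 2 := by
    intro k
    induction k with
    | zero => exact ⟨t₀, le_rfl, by simp⟩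
    | succ k ih =>
      obtain ⟨t, ht, h⟩ := ih
      obtain ⟨b, hb, hle⟩ := exists_unionGraph_Ici_le (σ := σ) (t + τ)
      refine ⟨b + τ, by linarith, ?_⟩
      calc _ ≤ θ * ‖x t‖ ^ 2 := hθ x t₀ t b ht₀ hx hfix ht hb ((hG _ (by linarith)).mono hle)
        _ ≤ θ * (θ ^ k * ‖x t₀‖ ^ 2) := by gcongr
        _ = _ := by ring
  have hlim : Tendsto (fun k : ℕ => θ ^ k * ‖x t₀‖ ^ 2) atTop (𝓝 0) := by
    simpa using (tendsto_pow_atTop_nhds_zero_of_lt_one hθ0.le hθ1).mul_const (‖x t₀‖ ^ 2)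
  rw [Metric.tendsto_atTop]
  intro ε hε
  obtain ⟨k, hk⟩ := (hlim.eventually (gt_mem_nhds (pow_pos hε 2))).exists
  obtain ⟨t, ht, h⟩ := hstep k
  refine ⟨t, fun s hs => ?_⟩
  have h1 : ‖x s‖ ^ 2 < ε ^ 2 := ((hx.norm_sq_le hiso hα ht hs).trans h).trans_lt hk
  rw [Real.dist_0_eq_abs, abs_of_nonneg (norm_nonneg _)]
  exact (sq_lt_sq₀ (norm_nonneg _) hε.le).1 h1

end Contraction

/-! ### Existence of solutions -/

section Existence

variable {Γ E : Type*} [NormedAddCommGroup E] [NormedSpace ℝ E] {σ : ℝ → Γ} {τ : ℝ}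

/-- The half-line `[t₀, ∞)` is cut by a sequence of breakpoints into intervals on which `σ` is
constant. -/
lemma exists_breakpoints (hr : ∀ t : ℝ, 0 ≤ t → ∀ᶠ s in 𝓝[≥] t, σ s = σ t) (hτ : 0 < τ)
    (hd : ∀ t : ℝ, 0 < t → (∀ᶠ s in 𝓝[<] t, σ s = σ t) ∨ ∀ s ∈ Ico t (t + τ), σ s = σ t)
    {t₀ : ℝ} (ht₀ : 0 ≤ t₀) :
    ∃ a : ℕ → ℝ, a 0 = t₀ ∧ StrictMono a ∧ Tendsto a atTop atTop ∧
      ∀ k, ∀ s ∈ Ico (a k) (a (k + 1)), σ s = σ (a k) := by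
  classical
  have hnext : ∀ t : ℝ, ∃ b : ℝ, 0 ≤ t → t < b ∧ (∀ s ∈ Ico t b, σ s = σ t) ∧
      ((∀ s ∈ Ico t (t + τ), σ s = σ t) → b = t + τ) ∧
      (b = t + τ ∨ ∀ s ∈ Ico b (b + τ), σ s = σ b) := by
    intro t
    by_cases ht : 0 ≤ t
    · by_cases hc : ∀ s ∈ Ico t (t + τ), σ s = σ t
      · exact ⟨t + τ, fun _ => ⟨by linarith, hc, fun _ => rfl, Or.inl rfl⟩⟩
      · obtain ⟨a, ha, ha1, ha2⟩ := exists_constant_interval hr hτ hd ht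
        have hta : t < a := lt_of_le_of_ne ha.1 fun h => hc (h ▸ ha2)
        exact ⟨a, fun _ => ⟨hta, ha1, fun h => absurd h hc, Or.inr ha2⟩⟩
    · exact ⟨0, fun h => absurd h ht⟩
  choose next hn using hnext
  let a : ℕ → ℝ := fun k => next^[k] t₀
  have hsucc : ∀ k, a (k + 1) = next (a k) := fun k => Function.iterate_succ_apply' next k t₀
  have hnn : ∀ k, 0 ≤ a k := by
    intro k
    induction k with
    | zero => exact ht₀
    | succ k ih => rw [hsucc]; exact ih.trans (hn _ ih).1.le
  have hmono : StrictMono a := strictMono_nat_of_lt_succ fun k => by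
    rw [hsucc]; exact (hn _ (hnn k)).1
  -- Two steps advance by at least the dwell time.
  have htwo : ∀ k, a k + τ ≤ a (k + 2) := by
    intro k
    rcases (hn _ (hnn k)).2.2.2 with h | h
    · rw [← h, ← hsucc]
      exact (hmono (Nat.lt_succ_self (k + 1))).le
    · have h1 := (hn _ (hnn (k + 1))).2.2.1 (by rw [hsucc]; exact h)
      rw [hsucc (k + 1), h1]
      linarith [hmono (Nat.lt_succ_self k)]
  have hge : ∀ k : ℕ, t₀ + k * τ ≤ a (2 * k) := by
    intro k
    induction k with
    | zero => simp [a]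
    | succ k ih =>
      have := htwo (2 * k)
      rw [show 2 * (k + 1) = 2 * k + 2 by ring]
      push_cast
      linarith
  refine ⟨a, rfl, hmono, tendsto_atTop_atTop_of_monotone hmono.monotone fun B => ?_, fun k => ?_⟩
  · obtain ⟨k, hk⟩ := exists_nat_ge ((B - t₀) / τ)
    exact ⟨2 * k, by linarith [hge k, (div_le_iff₀ hτ).1 hk]⟩
  · rw [hsucc]
    exact (hn _ (hnn k)).2.1

/-- Switched linear systems with a dwell time have solutions from every initial state: the
exponentials on the intervals between the breakpoints are glued. -/
lemma exists_solution [FiniteDimensional ℝ E] (L : Γ → E →ₗ[ℝ] E)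
    (hr : ∀ t : ℝ, 0 ≤ t → ∀ᶠ s in 𝓝[≥] t, σ s = σ t) (hτ : 0 < τ)
    (hd : ∀ t : ℝ, 0 < t → (∀ᶠ s in 𝓝[<] t, σ s = σ t) ∨ ∀ s ∈ Ico t (t + τ), σ s = σ t)
    {t₀ : ℝ} (ht₀ : 0 ≤ t₀) (x₀ : E) :
    ∃ x : ℝ → E, x t₀ = x₀ ∧ ContinuousOn x (Ici t₀) ∧
      ∀ t, t₀ < t → (∀ᶠ s in 𝓝 t, σ s = σ t) → HasDerivAt x (L (σ t) (x t)) t := by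
  classical
  have := FiniteDimensional.complete ℝ E
  obtain ⟨a, ha0, hmono, hlim, hconst⟩ := exists_breakpoints hr hτ hd ht₀
  let A : ℕ → E →L[ℝ] E := fun k => LinearMap.toContinuousLinearMap (L (σ (a k)))
  let z : ℕ → E := fun k => Nat.rec x₀ (fun k y => NormedSpace.exp ((a (k + 1) - a k) • A k) y) k
  let F : ℕ → ℝ → E := fun k t => NormedSpace.exp ((t - a k) • A k) (z k)
  have hFd : ∀ k t, HasDerivAt (F k) (L (σ (a k)) (F k t)) t := by
    intro k t
    have h1 := (hasDerivAt_exp_smul_const' (𝕂 := ℝ) (A k) (t - a k)).comp_sub_const t (a k)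
    exact ((ContinuousLinearMap.apply ℝ E (z k)).hasFDerivAt.comp_hasDerivAt t h1)
  have hFz : ∀ k, F k (a k) = z k := by
    intro k
    simp [F]
  have hFs : ∀ k, F k (a (k + 1)) = z (k + 1) := fun k => rfl
  have hex : ∀ t, ∃ k, t < a (k + 1) := fun t =>
    ((tendsto_add_atTop_nat 1).eventually (hlim.eventually_gt_atTop t)).exists.imp fun _ h => h
  let idx : ℝ → ℕ := fun t => Nat.find (hex t)
  have hidx : ∀ k t, t ∈ Ico (a k) (a (k + 1)) → idx t = k := by
    intro k t ht
    refine (Nat.find_eq_iff (hex t)).2 ⟨ht.2, fun m hm => not_lt.2 ?_⟩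
    exact (hmono.monotone hm).trans ht.1
  let x : ℝ → E := fun t => F (idx t) t
  have hxF : ∀ k, ∀ t ∈ Icc (a k) (a (k + 1)), x t = F k t := by
    intro k t ht
    rcases eq_or_lt_of_le ht.2 with h | h
    · have h1 : idx t = k + 1 := hidx (k + 1) t ⟨h.ge, by rw [h]; exact hmono (Nat.lt_succ_self _)⟩
      simp only [x, h1]
      rw [h, hFs, hFz]
    · simp only [x, hidx k t ⟨ht.1, h⟩]
  have hright : ∀ t, t₀ ≤ t → ∃ k, t ∈ Ico (a k) (a (k + 1)) := by
    intro t ht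
    refine ⟨idx t, ?_, Nat.find_spec (hex t)⟩
    rcases Nat.eq_zero_or_pos (idx t) with h | h
    · rw [h, ha0]; exact ht
    · have := Nat.find_min (hex t) (Nat.sub_lt h one_pos)
      rw [Nat.sub_add_cancel (show 1 ≤ Nat.find (hex t) from h)] at this
      exact not_lt.1 this
  have hleft : ∀ t, t₀ < t → ∃ k, t ∈ Ioc (a k) (a (k + 1)) := by
    intro t ht
    obtain ⟨k, hk⟩ := hright t ht.le
    rcases eq_or_lt_of_le hk.1 with h | h
    · cases k with
      | zero => exact absurd (ha0.symm.trans h) ht.ne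
      | succ k => exact ⟨k, by rw [← h]; exact hmono (Nat.lt_succ_self _), h.ge⟩
    · exact ⟨k, h, hk.2.le⟩
  have hdr : ∀ t k, t ∈ Ico (a k) (a (k + 1)) →
      HasDerivWithinAt x (L (σ (a k)) (x t)) (Ici t) t := by
    intro t k hk
    have h1 : x =ᶠ[𝓝[≥] t] F k := by
      filter_upwards [Icc_mem_nhdsGE hk.2] with s hs
      exact hxF k s ⟨hk.1.trans hs.1, hs.2⟩
    rw [hxF k t ⟨hk.1, hk.2.le⟩]
    exact (hFd k t).hasDerivWithinAt.congr_of_eventuallyEq h1 (hxF k t ⟨hk.1, hk.2.le⟩)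
  have hdl : ∀ t k, t ∈ Ioc (a k) (a (k + 1)) →
      HasDerivWithinAt x (L (σ (a k)) (x t)) (Iic t) t := by
    intro t k hk
    have h1 : x =ᶠ[𝓝[≤] t] F k := by
      filter_upwards [Icc_mem_nhdsLE hk.1] with s hs
      exact hxF k s ⟨hs.1, hs.2.trans hk.2⟩
    rw [hxF k t ⟨hk.1.le, hk.2⟩]
    exact (hFd k t).hasDerivWithinAt.congr_of_eventuallyEq h1 (hxF k t ⟨hk.1.le, hk.2⟩)
  refine ⟨x, ?_, fun t ht => ?_, fun t ht hev => ?_⟩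
  · have h0 : t₀ ∈ Icc (a 0) (a 1) := by rw [← ha0]; exact ⟨le_rfl, (hmono one_pos).le⟩
    rw [hxF 0 t₀ h0, ← ha0, hFz]
    exact rfl
  · obtain ⟨k, hk⟩ := hright t ht
    rcases eq_or_lt_of_le (mem_Ici.1 ht) with h | h
    · rw [h]
      exact (hdr t k hk).continuousWithinAt
    · obtain ⟨l, hl⟩ := hleft t h
      exact (continuousAt_iff_continuous_left_right.2
        ⟨(hdl t l hl).continuousWithinAt, (hdr t k hk).continuousWithinAt⟩).continuousWithinAt
  · obtain ⟨k, hk⟩ := hright t ht.le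
    obtain ⟨l, hl⟩ := hleft t ht
    have h1 := hdr t k hk
    have h2 := hdl t l hl
    rw [← hconst k t hk] at h1
    obtain ⟨s, hs1, hs2⟩ :=
      ((hev.filter_mono (nhdsWithin_le_nhds (s := Iio t))).and (Ioo_mem_nhdsLT hl.1)).exists
    rw [← hconst l s ⟨hs2.1.le, hs2.2.trans_le hl.2⟩, hs1] at h2
    have h3 := h2.union h1
    rwa [Iic_union_Ici, hasDerivWithinAt_univ] at h3

end Existence

/-! ### The action of permutations on operators -/

section Action

variable {n : ℕ}

lemma frobenius_norm_sq (A : Op n) : ‖A‖ ^ 2 = ∑ p, ∑ q, ‖A p q‖ ^ 2 := by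
  rw [Matrix.frobenius_norm_def, ← Real.sqrt_eq_rpow, Real.sq_sqrt (by positivity)]
  simp

/-- The real Hilbert space structure on operators that induces the Frobenius norm. -/
noncomputable instance : InnerProductSpace ℝ (Op n) :=
  { Matrix.frobeniusNormedSpace with
    inner := fun A B => ∑ p, ∑ q, inner ℝ (A p q) (B p q)
    norm_sq_eq_re_inner := fun A => by
      rw [frobenius_norm_sq]
      simp only [real_inner_self_eq_norm_sq]
      rfl
    conj_inner_symm := fun A B => by simp [real_inner_comm]
    add_left := fun A B C => by
      simp only [Matrix.add_apply, inner_add_left, Finset.sum_add_distrib]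
    smul_left := fun A B r => by
      simp only [Matrix.smul_apply, real_inner_smul_left, Finset.mul_sum]
      rfl }

/-- `ρ ↦ U_π ρ U_π†`, as a real linear map. -/
noncomputable def permConj (π : Equiv.Perm (Fin n)) : Op n →ₗ[ℝ] Op n where
  toFun ρ := permOp π * ρ * (permOp π).conjTranspose
  map_add' A B := by rw [Matrix.mul_add, Matrix.add_mul]
  map_smul' r A := by simp

lemma permConj_apply (π : Equiv.Perm (Fin n)) (ρ : Op n) (p q : Label n) :
    permConj π ρ p q = ρ (p ∘ π.symm) (q ∘ π.symm) := by
  have h : ∀ p r : Label n, (p = fun i => r (π i)) ↔ r = p ∘ π.symm := by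
    intro p r
    constructor
    · rintro rfl
      ext i
      simp
    · rintro rfl
      ext i
      simp
  simp only [permConj, LinearMap.coe_mk, AddHom.coe_mk, Matrix.mul_apply, permOp, Matrix.of_apply,
    Matrix.conjTranspose_apply, h]
  simp

lemma permConj_one (ρ : Op n) : permConj 1 ρ = ρ := by
  ext p q
  rw [permConj_apply]
  rfl

/-- The convention `U_π |q₁ … qₙ⟩ = |q_{π(1)} … q_{π(n)}⟩` makes `π ↦ U_π` reverse products. -/
lemma permConj_permConj (π τ : Equiv.Perm (Fin n)) (ρ : Op n) :
    permConj τ (permConj π ρ) = permConj (π * τ) ρ := by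
  ext p q
  simp only [permConj_apply]
  rfl

lemma norm_permConj (π : Equiv.Perm (Fin n)) (ρ : Op n) : ‖permConj π ρ‖ = ‖ρ‖ := by
  have h : ‖permConj π ρ‖ ^ 2 = ‖ρ‖ ^ 2 := by
    rw [frobenius_norm_sq, frobenius_norm_sq]
    simp only [permConj_apply]
    let e : Label n ≃ Label n := Equiv.arrowCongr π (Equiv.refl _)
    exact (Equiv.sum_comp e fun p => ∑ q, ‖ρ p (q ∘ π.symm)‖ ^ 2).trans
      (Finset.sum_congr rfl fun p _ => Equiv.sum_comp e fun q => ‖ρ p q‖ ^ 2)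
  exact (pow_left_inj₀ (norm_nonneg _) (norm_nonneg _) two_ne_zero).1 h

/-- The swap `ρ ↦ U_{jk} ρ U_{jk}†`. -/
noncomputable def swapConj (j k : Fin n) : Op n →ₗ[ℝ] Op n := permConj (Equiv.swap j k)

lemma norm_swapConj (j k : Fin n) (ρ : Op n) : ‖swapConj j k ρ‖ = ‖ρ‖ := norm_permConj _ ρ

lemma swapConj_swapConj (j k : Fin n) (ρ : Op n) : swapConj j k (swapConj j k ρ) = ρ := by
  rw [swapConj, permConj_permConj, Equiv.swap_mul_self, permConj_one]

lemma consensusField_eq (α : Fin n → Fin n → ℝ) (G : SimpleGraph (Fin n)) (ρ : Op n) :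
    consensusField α G ρ = swapField swapConj α G ρ := by
  classical
  rw [swapField_apply, edgePairs, Finset.sum_filter, ← Finset.univ_product_univ,
    Finset.sum_product, consensusField]
  refine Finset.sum_congr rfl fun j _ => Finset.sum_congr rfl fun k _ => ?_
  by_cases h : j < k ∧ G.Adj j k
  · rw [if_pos h, if_pos h, Complex.coe_smul]
    rfl
  · rw [if_neg h, if_neg h]

/-- The quantum average, as a real linear map. -/
noncomputable def averageMap (n : ℕ) : Op n →ₗ[ℝ] Op n :=
  ((n.factorial : ℝ))⁻¹ • ∑ π : Equiv.Perm (Fin n), permConj π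

lemma averageMap_apply (ρ : Op n) :
    averageMap n ρ = ((n.factorial : ℝ))⁻¹ • ∑ π : Equiv.Perm (Fin n), permConj π ρ := by
  simp [averageMap]

lemma quantumAverage_eq (ρ : Op n) : quantumAverage ρ = averageMap n ρ := by
  rw [averageMap_apply, quantumAverage, ← Complex.coe_smul]
  push_cast
  rfl

lemma averageMap_permConj (π : Equiv.Perm (Fin n)) (ρ : Op n) :
    averageMap n (permConj π ρ) = averageMap n ρ := by
  simp only [averageMap_apply, permConj_permConj]
  exact congrArg _ (Equiv.sum_comp (Equiv.mulLeft π) fun τ => permConj τ ρ)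

lemma permConj_averageMap (π : Equiv.Perm (Fin n)) (ρ : Op n) :
    permConj π (averageMap n ρ) = averageMap n ρ := by
  simp only [averageMap_apply, map_smul, map_sum, permConj_permConj]
  exact congrArg _ (Equiv.sum_comp (Equiv.mulRight π) fun τ => permConj τ ρ)

lemma averageMap_of_forall_permConj {v : Op n} (hv : ∀ π, permConj π v = v) :
    averageMap n v = v := by
  rw [averageMap_apply, Finset.sum_congr rfl fun π _ => hv π, Finset.sum_const, Finset.card_univ,
    Fintype.card_perm, Fintype.card_fin, ← Nat.cast_smul_eq_nsmul ℝ, smul_smul,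
    inv_mul_cancel₀ (by positivity), one_smul]

lemma norm_averageMap_le (ρ : Op n) : ‖averageMap n ρ‖ ≤ ‖ρ‖ := by
  rw [averageMap_apply, norm_smul, Real.norm_of_nonneg (by positivity)]
  have h : ‖∑ π : Equiv.Perm (Fin n), permConj π ρ‖ ≤ n.factorial * ‖ρ‖ := by
    refine (norm_sum_le _ _).trans_eq ?_
    simp [norm_permConj, Fintype.card_perm]
  calc _ ≤ ((n.factorial : ℝ))⁻¹ * (n.factorial * ‖ρ‖) := by gcongr
    _ = ‖ρ‖ := by rw [← mul_assoc, inv_mul_cancel₀ (by positivity), one_mul]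

/-- The swaps along the edges of a connected graph generate the symmetric group. -/
lemma permConj_of_mem_fixedVectors {F : SimpleGraph (Fin n)} (hF : F.Connected) {v : Op n}
    (hv : v ∈ fixedVectors swapConj F) (π : Equiv.Perm (Fin n)) : permConj π v = v := by
  let M : Submonoid (Equiv.Perm (Fin n)) :=
    { carrier := {π | permConj π v = v}
      one_mem' := permConj_one v
      mul_mem' := fun {π τ} (hπ : permConj π v = v) (hτ : permConj τ v = v) => by
        change permConj (π * τ) v = v
        rw [← permConj_permConj, hπ, hτ] }
  have hadj : ∀ j k, F.Adj j k → Equiv.swap j k ∈ M := by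
    intro j k h
    rcases lt_or_gt_of_ne h.ne with hlt | hlt
    · exact hv (j, k) (mem_edgePairs.2 ⟨hlt, h⟩)
    · rw [Equiv.swap_comm]
      exact hv (k, j) (mem_edgePairs.2 ⟨hlt, h.symm⟩)
  have hwalk : ∀ j k, F.Reachable j k → Equiv.swap j k ∈ M := by
    rintro j k ⟨w⟩
    induction w with
    | nil => rw [Equiv.swap_self]; exact M.one_mem
    | cons h _ ih => exact SubmonoidClass.swap_mem_trans M (hadj _ _ h) ih
  have htop : (⊤ : Submonoid (Equiv.Perm (Fin n))) ≤ M := by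
    rw [← Equiv.Perm.mclosure_isSwap, Submonoid.closure_le]
    rintro _ ⟨j, k, -, rfl⟩
    exact hwalk j k (hF.preconnected j k)
  exact htop (Submonoid.mem_top π)

lemma fixedVectors_subset_top (F : SimpleGraph (Fin n)) (hF : F.Connected) :
    fixedVectors (swapConj (n := n)) F ⊆ fixedVectors swapConj ⊤ :=
  fun _ hv _ _ => permConj_of_mem_fixedVectors hF hv _

lemma averageMap_mem_fixedVectors (ρ : Op n) (F : SimpleGraph (Fin n)) :
    averageMap n ρ ∈ fixedVectors swapConj F := fun _ _ => permConj_averageMap _ ρ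

lemma averageMap_swapField (α : Fin n → Fin n → ℝ) (G : SimpleGraph (Fin n)) (ρ : Op n) :
    averageMap n (swapField swapConj α G ρ) = 0 := by
  rw [swapField_apply, map_sum]
  refine Finset.sum_eq_zero fun p _ => ?_
  rw [map_smul, map_sub, swapConj, averageMap_permConj, sub_self, smul_zero]

end Action

/-! ### Solutions of the master equation -/

section Solutions

variable {n : ℕ} {α : Fin n → Fin n → ℝ} {σ : ℝ → SimpleGraph (Fin n)} {t₀ : ℝ} {ρ : ℝ → Op n}

lemma IsSolution.isTrajectory (hσ : IsSwitchingSignal σ) (ht₀ : 0 ≤ t₀)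
    (hρ : IsSolution α σ t₀ ρ) : IsTrajectory (swapField swapConj α) σ t₀ ρ := by
  refine isTrajectory_of_hasDerivAt hσ.1 ht₀ hρ.1 fun t ht hev => ?_
  rw [← consensusField_eq]
  exact hρ.2 t ht fun h => h.2 hev

lemma exists_isSolution (hσ : IsSwitchingSignal σ) (ht₀ : 0 ≤ t₀) (ρ₀ : Op n) :
    ∃ ρ, IsSolution α σ t₀ ρ ∧ ρ t₀ = ρ₀ := by
  obtain ⟨τ, hτ, hd⟩ := hσ.exists_dwell
  obtain ⟨ρ, h0, hc, h⟩ := exists_solution (swapField (swapConj (n := n)) α) hσ.1 hτ hd ht₀ ρ₀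
  refine ⟨ρ, ⟨hc, fun t ht hsw => ?_⟩, h0⟩
  have hev : ∀ᶠ s in 𝓝 t, σ s = σ t := by
    by_contra hn
    exact hsw ⟨ht₀.trans_lt ht, hn⟩
  rw [consensusField_eq]
  exact h t ht hev

lemma IsTrajectory.averageMap_eq (hρ : IsTrajectory (swapField swapConj α) σ t₀ ρ) {t : ℝ}
    (ht : t₀ ≤ t) : averageMap n (ρ t) = averageMap n (ρ t₀) := by
  have hc : Continuous (averageMap n) := (averageMap n).continuous_of_finiteDimensional
  refine constant_of_has_deriv_right_zero (f := fun s => averageMap n (ρ s)) (b := t)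
    (hc.comp_continuousOn (hρ.continuousOn_Icc le_rfl)) (fun s hs => ?_) t ⟨ht, le_rfl⟩
  have h := (ContinuousLinearMap.hasFDerivAt (⟨averageMap n, hc⟩ : Op n →L[ℝ] Op n)
    ).comp_hasDerivWithinAt s (hρ.2 s hs.1)
  refine h.congr_deriv ?_
  exact averageMap_swapField α (σ s) (ρ s)

lemma IsTrajectory.sub_averageMap (hρ : IsTrajectory (swapField swapConj α) σ t₀ ρ) :
    IsTrajectory (swapField swapConj α) σ t₀ (fun t => ρ t - averageMap n (ρ t₀)) :=
  hρ.sub_const fun g => swapField_of_mem_fixedVectors (averageMap_mem_fixedVectors _ g)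

/-- The deviation from the average has zero average, so its norm is comparable to its distance to
the permutation invariant operators. -/
lemma IsTrajectory.norm_sub_averageMap_le (hn : 1 ≤ n)
    (hρ : IsTrajectory (swapField swapConj α) σ t₀ ρ) (t : ℝ) (ht : t₀ ≤ t) (v : Op n)
    (hv : v ∈ fixedVectors swapConj ⊤) :
    ‖ρ t - averageMap n (ρ t₀)‖ ≤ 2 * ‖ρ t - averageMap n (ρ t₀) - v‖ := by
  have : Nonempty (Fin n) := ⟨⟨0, hn⟩⟩
  have hv' : averageMap n v = v :=
    averageMap_of_forall_permConj (permConj_of_mem_fixedVectors SimpleGraph.connected_top hv)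
  set y := ρ t - averageMap n (ρ t₀) with hy
  have h0 : averageMap n y = 0 := by
    rw [hy, map_sub, hρ.averageMap_eq ht,
      averageMap_of_forall_permConj (v := averageMap n (ρ t₀)) fun π => permConj_averageMap π _,
      sub_self]
  have h1 : y = (y - v) - averageMap n (y - v) := by
    rw [map_sub, h0, hv']
    abel
  calc ‖y‖ = ‖(y - v) - averageMap n (y - v)‖ := by rw [← h1]
    _ ≤ ‖y - v‖ + ‖averageMap n (y - v)‖ := _root_.norm_sub_le _ _
    _ ≤ ‖y - v‖ + ‖y - v‖ := by gcongr; exact norm_averageMap_le _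
    _ = _ := by ring

end Solutions

/-! ### Connectivity implies consensus -/

section Sufficiency

variable {n : ℕ} {α : Fin n → Fin n → ℝ} {σ : ℝ → SimpleGraph (Fin n)}

lemma globalExponentialConsensus_of_connected (hn : 1 ≤ n) (hpos : ∀ j k, j ≠ k → 0 < α j k)
    (hσ : IsSwitchingSignal σ) {T : ℝ} (hT : 0 < T)
    (hG : ∀ t : ℝ, 0 ≤ t → (unionGraph σ (Ico t (t + T))).Connected) :
    GlobalExponentialConsensus α σ univ := by
  obtain ⟨τ, hτ, hd⟩ := hσ.exists_dwell
  obtain ⟨M, γ, hM, hγ, h⟩ := exists_exponential_decay (S := swapConj (n := n)) hpos norm_swapConj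
    swapConj_swapConj fixedVectors_subset_top hσ.1 hτ hd hT hG
  refine ⟨fun ρ₀ => M * ‖ρ₀ - averageMap n ρ₀‖ + 1, fun ρ₀ => by positivity, γ, hγ,
    fun t₀ ht₀ ρ hρ _ t ht => ?_⟩
  have hx := hρ.isTrajectory hσ ht₀
  rw [quantumAverage_eq]
  refine (h _ t₀ ht₀ hx.sub_averageMap (hx.norm_sub_averageMap_le hn) t ht).trans ?_
  gcongr
  linarith

lemma globalAsymptoticConsensus_of_connected (hn : 1 ≤ n) (hpos : ∀ j k, j ≠ k → 0 < α j k)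
    (hσ : IsSwitchingSignal σ) (hG : ∀ t : ℝ, 0 ≤ t → (unionGraph σ (Ici t)).Connected) :
    GlobalAsymptoticConsensus α σ univ := by
  obtain ⟨τ, hτ, hd⟩ := hσ.exists_dwell
  intro t₀ ht₀ ρ hρ _
  have hx := hρ.isTrajectory hσ ht₀
  have h := tendsto_zero_of_connected hpos norm_swapConj swapConj_swapConj fixedVectors_subset_top
    hσ.1 hτ hd hG ht₀ hx.sub_averageMap (hx.norm_sub_averageMap_le hn)
  rw [quantumAverage_eq]
  exact tendsto_iff_norm_sub_tendsto_zero.2 h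

end Sufficiency

/-! ### Consensus implies connectivity -/

section Necessity

variable {n : ℕ} {α : Fin n → Fin n → ℝ} {σ : ℝ → SimpleGraph (Fin n)}

/-- The pure state `|q⟩⟨q|` of a computational basis vector. -/
def basisState (q : Label n) : Op n := Matrix.diagonal fun p => if p = q then 1 else 0

lemma basisState_mem_densityOperators (q : Label n) : basisState q ∈ densityOperators n := by
  constructor
  · refine Matrix.PosSemidef.diagonal fun p => ?_
    by_cases h : p = q <;> simp [h]
  · simp [basisState, Matrix.trace_diagonal]

lemma permConj_basisState (π : Equiv.Perm (Fin n)) (q : Label n) :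
    permConj π (basisState q) = basisState (q ∘ π) := by
  ext p r
  have h1 : p ∘ π.symm = r ∘ π.symm ↔ p = r := π.symm.surjective.injective_comp_right.eq_iff
  have h2 : p ∘ π.symm = q ↔ p = q ∘ π := Equiv.comp_symm_eq π q p
  rw [permConj_apply]
  simp only [basisState, Matrix.diagonal_apply, h1, h2]

lemma basisState_injective : Function.Injective (basisState (n := n)) := by
  intro q r h
  have := congrFun (congrFun h q) q
  by_contra hne
  simp [basisState, hne] at this

/-- If `G` is disconnected, the basis state labelled by the indicator of a component is invariant
under the swaps along edges of `G`, but not permutation invariant. -/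
lemma exists_basisState_mem_fixedVectors (hn : 1 ≤ n) {G : SimpleGraph (Fin n)}
    (hG : ¬ G.Connected) :
    ∃ q : Label n, basisState q ∈ fixedVectors swapConj G ∧
      averageMap n (basisState q) ≠ basisState q := by
  classical
  have : Nonempty (Fin n) := ⟨⟨0, hn⟩⟩
  obtain ⟨u, v, huv⟩ : ∃ u v, ¬ G.Reachable u v := by
    by_contra! h
    exact hG ⟨h⟩
  let q : Label n := fun i => if G.Reachable u i then 1 else 0
  have hu : q u = 1 := if_pos (SimpleGraph.Reachable.refl u)
  have hv : q v = 0 := if_neg huv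
  refine ⟨q, fun p hp => ?_, fun h => ?_⟩
  · have hadj := (mem_edgePairs.1 hp).2
    have hq : q p.1 = q p.2 := by
      have : G.Reachable u p.1 ↔ G.Reachable u p.2 :=
        ⟨fun h => h.trans hadj.reachable, fun h => h.trans hadj.symm.reachable⟩
      simp only [q, this]
    rw [swapConj, permConj_basisState]
    congr 1
    ext i
    rcases eq_or_ne i p.1 with rfl | h1
    · simp [hq]
    rcases eq_or_ne i p.2 with rfl | h2
    · simp [hq]
    simp [Equiv.swap_apply_of_ne_of_ne h1 h2]
  · have h1 : permConj (Equiv.swap u v) (basisState q) = basisState q := by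
      rw [← h, permConj_averageMap]
    rw [permConj_basisState] at h1
    have h2 := congrFun (basisState_injective h1) u
    simp [hu, hv] at h2

lemma connected_of_globalAsymptoticConsensus (hn : 1 ≤ n)
    (h : GlobalAsymptoticConsensus α σ (densityOperators n)) (t : ℝ) (ht : 0 ≤ t) :
    (unionGraph σ (Ici t)).Connected := by
  by_contra hG
  obtain ⟨q, hq, hne⟩ := exists_basisState_mem_fixedVectors hn hG
  -- the constant function is a solution that does not converge to its average
  have hsol : IsSolution α σ t fun _ => basisState q := by
    refine ⟨continuousOn_const, fun s hs _ => ?_⟩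
    rw [consensusField_eq, swapField_of_mem_fixedVectors
      (fixedVectors_anti (le_unionGraph (mem_Ici.2 hs.le)) hq)]
    exact hasDerivAt_const ..
  have hlim := h t ht _ hsol (basisState_mem_densityOperators q)
  rw [quantumAverage_eq] at hlim
  exact hne (tendsto_nhds_unique hlim tendsto_const_nhds)

lemma connected_of_globalExponentialConsensus (hn : 1 ≤ n) (hpos : ∀ j k, j ≠ k → 0 < α j k)
    (hσ : IsSwitchingSignal σ) (h : GlobalExponentialConsensus α σ (densityOperators n)) :
    ∃ T : ℝ, 0 < T ∧ ∀ t : ℝ, 0 ≤ t → (unionGraph σ (Ico t (t + T))).Connected := by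
  obtain ⟨C, -, γ, hγ, h⟩ := h
  have hev : ∀ q : Label n, ∀ᶠ T : ℝ in atTop, averageMap n (basisState q) ≠ basisState q →
      C (basisState q) * Real.exp (-γ * T) < ‖basisState q - averageMap n (basisState q)‖ := by
    intro q
    by_cases hq : averageMap n (basisState q) = basisState q
    · exact Eventually.of_forall fun _ h => absurd hq h
    have h1 : Tendsto (fun T : ℝ => -γ * T) atTop atBot :=
      tendsto_id.const_mul_atTop_of_neg (neg_lt_zero.2 hγ)
    have h2 : Tendsto (fun T : ℝ => C (basisState q) * Real.exp (-γ * T)) atTop (𝓝 0) := by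
      simpa using (Real.tendsto_exp_atBot.comp h1).const_mul (C (basisState q))
    have h3 : 0 < ‖basisState q - averageMap n (basisState q)‖ :=
      norm_pos_iff.2 (sub_ne_zero.2 (Ne.symm hq))
    exact (h2.eventually (gt_mem_nhds h3)).mono fun _ h _ => h
  obtain ⟨T, hT, hT0⟩ := ((eventually_all.2 hev).and (eventually_gt_atTop 0)).exists
  refine ⟨T, hT0, fun t ht => ?_⟩
  by_contra hG
  obtain ⟨q, hq, hne⟩ := exists_basisState_mem_fixedVectors hn hG
  obtain ⟨ρ, hρ, h0⟩ := exists_isSolution (α := α) hσ ht (basisState q)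
  -- the solution starting from this state at time `t` is still there at time `t + T`
  have hstay : ρ (t + T) = basisState q := by
    have h1 := (hρ.isTrajectory hσ ht).norm_sub_le norm_swapConj hpos hq le_rfl
      (by linarith : t ≤ t + T) fun s hs => le_unionGraph hs
    rw [h0, sub_self, norm_zero] at h1
    have h2 : ‖ρ (t + T) - basisState q‖ = 0 := by
      have := norm_nonneg (ρ (t + T) - basisState q)
      nlinarith
    exact sub_eq_zero.1 (norm_eq_zero.1 h2)
  have h1 := h t ht ρ hρ (h0 ▸ basisState_mem_densityOperators q) (t + T) (by linarith)
  rw [hstay, h0, quantumAverage_eq, add_sub_cancel_left] at h1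
  exact absurd h1 (not_le.2 (hT q hne))

end Necessity

lemma GlobalExponentialConsensus.mono {n : ℕ} {α : Fin n → Fin n → ℝ}
    {σ : ℝ → SimpleGraph (Fin n)} {S S' : Set (Op n)} (hS : S ⊆ S')
    (h : GlobalExponentialConsensus α σ S') : GlobalExponentialConsensus α σ S := by
  obtain ⟨C, hC, γ, hγ, h⟩ := h
  exact ⟨C, hC, γ, hγ, fun t₀ ht₀ ρ hρ hmem => h t₀ ht₀ ρ hρ (hS hmem)⟩

lemma GlobalAsymptoticConsensus.mono {n : ℕ} {α : Fin n → Fin n → ℝ}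
    {σ : ℝ → SimpleGraph (Fin n)} {S S' : Set (Op n)} (hS : S ⊆ S')
    (h : GlobalAsymptoticConsensus α σ S') : GlobalAsymptoticConsensus α σ S :=
  fun t₀ ht₀ ρ hρ hmem => h t₀ ht₀ ρ hρ (hS hmem)

end QuantumConsensus

theorem theorem5 (n : ℕ) (hn : 1 ≤ n)
    (α : Fin n → Fin n → ℝ) (hsymm : ∀ j k, α j k = α k j) (hpos : ∀ j k, j ≠ k → 0 < α j k)
    (σ : ℝ → SimpleGraph (Fin n)) (hσ : QuantumConsensus.IsSwitchingSignal σ) :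
    -- (i) exponential consensus, from all density operators and from all matrices
    ((QuantumConsensus.GlobalExponentialConsensus α σ (QuantumConsensus.densityOperators n) ↔
        ∃ T : ℝ, 0 < T ∧ ∀ t : ℝ, 0 ≤ t →
          (QuantumConsensus.unionGraph σ (Set.Ico t (t + T))).Connected) ∧
      (QuantumConsensus.GlobalExponentialConsensus α σ Set.univ ↔
        ∃ T : ℝ, 0 < T ∧ ∀ t : ℝ, 0 ≤ t →
          (QuantumConsensus.unionGraph σ (Set.Ico t (t + T))).Connected)) ∧
    -- (ii) asymptotic consensus, from all density operators and from all matrices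
    ((QuantumConsensus.GlobalAsymptoticConsensus α σ (QuantumConsensus.densityOperators n) ↔
        ∀ t : ℝ, 0 ≤ t → (QuantumConsensus.unionGraph σ (Set.Ici t)).Connected) ∧
      (QuantumConsensus.GlobalAsymptoticConsensus α σ Set.univ ↔
        ∀ t : ℝ, 0 ≤ t → (QuantumConsensus.unionGraph σ (Set.Ici t)).Connected)) := by
  have hd := Set.subset_univ (QuantumConsensus.densityOperators n)
  refine ⟨⟨⟨fun h => ?_, fun h => ?_⟩, ⟨fun h => ?_, fun h => ?_⟩⟩,
    ⟨⟨fun h => ?_, fun h => ?_⟩, ⟨fun h => ?_, fun h => ?_⟩⟩⟩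
  · exact QuantumConsensus.connected_of_globalExponentialConsensus hn hpos hσ h
  · obtain ⟨T, hT, hG⟩ := h
    exact (QuantumConsensus.globalExponentialConsensus_of_connected hn hpos hσ hT hG).mono hd
  · exact QuantumConsensus.connected_of_globalExponentialConsensus hn hpos hσ (h.mono hd)
  · obtain ⟨T, hT, hG⟩ := h
    exact QuantumConsensus.globalExponentialConsensus_of_connected hn hpos hσ hT hG
  · exact QuantumConsensus.connected_of_globalAsymptoticConsensus hn h
  · exact (QuantumConsensus.globalAsymptoticConsensus_of_connected hn hpos hσ h).mono hd
  · exact QuantumConsensus.connected_of_globalAsymptoticConsensus hn (h.mono hd)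
  · exact QuantumConsensus.globalAsymptoticConsensus_of_connected hn hpos hσ h
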